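/- **Theorem.** Checking artifact termination of unidirectional BAUML models is undecidable: there is no algorithm which, given (a code of) a unidirectional BAUML model $\mathcal B$ whose constraints are satisfied by the empty information base, decides whether $\mathcal B$, started from the empty information base, satisfies the artifact termination property. No bound is imposed on the multiplicities of association roles. *Models.* A BAUML model is a tuple $\mathcal B=\langle \mathcal M,\mathcal O,\mathcal S,\mathcal P\rangle$, where: - $\mathcal M$ is a UML class diagram (classes, an acyclic subclass relation, binary associations with a role and a multiplicity at each end, single-valued attributes), whose classes and associations are partitioned into read-only and read-write ones. Some classes are artifacts; each artifact is the top of a hierarchy of read-write classes (with no class in two such hierarchies) whose leaves are the states of the artifact, one of them being its termination state $t_A$. - $\mathcal O$ is a finite set of OCL constraints. - $\mathcal S$ contains one state transition diagram per artifact, over its states. Each transition carries an event and an OCL condition; initial transitions lead to the initial state and create an artifact instance. - $\mathcal P$ contains one activity diagram per event, built from initial, final, action, decision, merge, fork and join nodes. Each action is a task with an OCL precondition and postcondition. Each task takes an artifact instance in input, except the $\mathit{init}$ operations, which belong to initial transitions and return a newly created instance (and tasks of initial transitions executed before that creation). OCL expressions are built with Boolean connectives and quantification from inclusion and emptiness tests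 on paths $o.r_1\cdots r_n$ (with $o$ a variable or $C.\mathrm{allInstances}()$, possibly with @pre), equality comparison of data values drawn from a countably infinite unordered domain, $\mathrm{oclIsNew}$, $\mathrm{oclIsTypeOf}$ and $\mathrm{oclIsKindOf}$. *Unidirectional models.* An OCL expression is navigational if each of its paths either starts from a variable (the artifact instance or a variable of the expression) or uses only read-only names. $\mathcal B$ is navigational if all its conditions, and the pre- and postconditions of all its tasks other than $\mathit{init}$ operations, are navigational. A role is a target role if some OCL expression of $\mathcal B$ mentions it. A class $D$ depends on a class $C$ if there are $n\ge 1$, classes $C=C_1,\dots,C_{n+1}=D$ and associations $A_1,\dots,A_n$ such that $A_i$ connects $C_i$ and $C_{i+1}$ and the role of $A_i$ attached to $C_{i+1}$ is a target role. $\mathcal B$ is unidirectional if it is navigational and no read-write class depends on itself or on one of its super- or subclasses. *Semantics.* An information base is a finite set of facts giving each object one direct class, the links, and the attribute values; it is legal if it respects $\mathcal M$ and $\mathcal O$ and every artifact instance is in one of its states. Artifact instances evolve concurrently by interleaving: an event triggers a transition of an instance that is in the source state and not running an activity (or an initial transition) when its condition holds; its activity diagram is then executed with the usual token semantics, and ends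 at a final node when the instance is in the target state. A task can be executed, for some values of its input parameters, when its precondition holds; it leads to any legal information base that has the same read-only part, satisfies the postcondition, and is obtained by an inclusion-minimal set of insertions and deletions of facts. *Artifact termination* is the property $$\nu Z.\Big(\bigwedge_{A\text{ artifact}} \forall x.\,A(x)\rightarrow \mu Y.\,t_A(x)\vee (A(x)\wedge\langle -\rangle Y)\Big)\wedge[-]Z$$ evaluated at the initial state of the resulting transition system. -/

import Mathlib

namespace BAUML

/-!
All names (of classes, associations, attributes, variables, parameters, events), all object
identifiers and all data values are natural numbers. Data values are only ever compared for
equality. Classes are `0, …, numClasses - 1`; associations, attributes, events and activity-diagram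
nodes and edges are referred to by their position in the corresponding list.
-/

/-! ### Class diagrams -/

/-- A multiplicity `lower..upper`; `upper = none` stands for `*`. -/
structure Multiplicity where
  lower : ℕ
  upper : Option ℕ

/-- A binary association. `imMult` is attached to the image role (it bounds the number of image
objects linked to one domain object), `domMult` is attached to the domain role. -/
structure Assoc where
  dom : ℕ
  im : ℕ
  domMult : Multiplicity
  imMult : Multiplicity

/-- A single-valued (string) attribute, of multiplicity `1..1` or `0..1`. -/
structure Attr where
  owner : ℕ
  required : Bool

/-- A UML class diagram, with its partition into a read-only part (listed) and a read-write part
(everything else). `isa` lists the pairs (direct subclass, direct superclass). -/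
structure ClassDiagram where
  numClasses : ℕ
  isa : List (ℕ × ℕ)
  assocs : List Assoc
  attrs : List Attr
  roClasses : List ℕ
  roAssocs : List ℕ

/-- `M.Sub c d`: `c = d`, or `c` is a direct or indirect subclass of `d`. -/
def ClassDiagram.Sub (M : ClassDiagram) : ℕ → ℕ → Prop :=
  Relation.ReflTransGen (fun c d => (c, d) ∈ M.isa)

/-- `c` has no proper subclass. -/
def ClassDiagram.IsLeaf (M : ClassDiagram) (c : ℕ) : Prop :=
  ∀ d, (d, c) ∉ M.isa

/-- The attribute `a` belongs to a read-only class. -/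
def ClassDiagram.ROAttr (M : ClassDiagram) (a : ℕ) : Prop :=
  ∃ d, M.attrs[a]? = some d ∧ d.owner ∈ M.roClasses

/-! ### Information bases -/

/-- The facts an information base consists of: `inst o c` says that `c` is the direct (most
specific) class of the object `o`; `link r o o'` that `(o, o')` is in the association `r`;
`val a o v` that the attribute `a` of `o` has the value `v`. -/
inductive Fact
  | inst (o c : ℕ)
  | link (r o o' : ℕ)
  | val (a o v : ℕ)
  deriving DecidableEq

/-- An information base. -/
abbrev InfoBase := Finset Fact

/-- The object `o` exists in `I`. -/
def InfoBase.Exists (I : InfoBase) (o : ℕ) : Prop := ∃ c, Fact.inst o c ∈ I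

/-- `o` is an instance of `c` in `I` (directly, or through a subclass). -/
def ClassDiagram.HasType (M : ClassDiagram) (I : InfoBase) (o c : ℕ) : Prop :=
  ∃ d, Fact.inst o d ∈ I ∧ M.Sub d c

/-- Facts about the read-only part of the diagram. -/
def ClassDiagram.ROFact (M : ClassDiagram) : Fact → Prop
  | .inst _ c => c ∈ M.roClasses
  | .link r _ _ => r ∈ M.roAssocs
  | .val a _ _ => M.ROAttr a

/-- The number `n` is allowed by the multiplicity. -/
def Multiplicity.Allows (m : Multiplicity) (n : ℕ) : Prop :=
  m.lower ≤ n ∧ ∀ u, m.upper = some u → n ≤ u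

/-- `I` is an instance of the class diagram: every object has a single direct class, links and
attribute values are well typed, multiplicities are respected. -/
structure ClassDiagram.IsInstance (M : ClassDiagram) (I : InfoBase) : Prop where
  inst_class : ∀ o c, Fact.inst o c ∈ I → c < M.numClasses
  inst_unique : ∀ o c d, Fact.inst o c ∈ I → Fact.inst o d ∈ I → c = d
  link_typed : ∀ r o o', Fact.link r o o' ∈ I →
    ∃ a, M.assocs[r]? = some a ∧ M.HasType I o a.dom ∧ M.HasType I o' a.im
  im_mult : ∀ (r : ℕ) (a : Assoc) (o : ℕ), M.assocs[r]? = some a → M.HasType I o a.dom →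
    a.imMult.Allows (Set.ncard {o' | Fact.link r o o' ∈ I})
  dom_mult : ∀ (r : ℕ) (a : Assoc) (o' : ℕ), M.assocs[r]? = some a → M.HasType I o' a.im →
    a.domMult.Allows (Set.ncard {o | Fact.link r o o' ∈ I})
  val_typed : ∀ a o v, Fact.val a o v ∈ I → ∃ d, M.attrs[a]? = some d ∧ M.HasType I o d.owner
  val_unique : ∀ a o v w, Fact.val a o v ∈ I → Fact.val a o w ∈ I → v = w
  val_required : ∀ (a : ℕ) (d : Attr) (o : ℕ), M.attrs[a]? = some d → d.required = true → M.HasType I o d.owner →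
    ∃ v, Fact.val a o v ∈ I

/-! ### OCL -/

/-- An association end: the image role of `assoc` if `toIm`, else its domain role. -/
structure Role where
  assoc : ℕ
  toIm : Bool

/-- One navigation step `.r` or `.r@pre`. -/
structure NavStep where
  role : Role
  atPre : Bool

/-- The start of a path: a variable, or `C.allInstances()` (possibly `@pre`). -/
inductive Source
  | var (x : ℕ)
  | allInstances (c : ℕ) (atPre : Bool)

/-- A path `source.r₁ ⋯ rₙ`, denoting a set of objects. -/
structure Path where
  source : Source
  steps : List NavStep

/-- Expressions denoting sets of data values: a constant, an input parameter of the operation, or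
a path that ends in an attribute (possibly `@pre`). -/
inductive ValExpr
  | const (v : ℕ)
  | param (i : ℕ)
  | attr (p : Path) (a : ℕ) (atPre : Bool)

/-- OCL expressions. Equality of (collections of) objects or values is inclusion in both
directions; `select` and `let` are expressible with the quantifiers. -/
inductive OCL
  | tt
  | isEmpty (p : Path)
  | includesAll (p q : Path)
  | valIncludesAll (s t : ValExpr)
  | oclIsNew (x : ℕ)
  | oclIsTypeOf (x c : ℕ)
  | oclIsKindOf (x c : ℕ)
  | not (φ : OCL)
  | and (φ ψ : OCL)
  | or (φ ψ : OCL)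
  | exists_ (p : Path) (x : ℕ) (φ : OCL)
  | forAll (p : Path) (x : ℕ) (φ : OCL)

/-! Expressions are evaluated over a pair of information bases: `I₀` (the state before the
operation, addressed by `@pre` and `oclIsNew`) and `I` (the current one). Preconditions, conditions
and constraints are evaluated with `I₀ = I`. A variable or parameter without value denotes `∅`. -/

def Source.eval (M : ClassDiagram) (I₀ I : InfoBase) (ρ : ℕ → Option ℕ) : Source → Set ℕ
  | .var x => {o | ρ x = some o}
  | .allInstances c atPre => {o | M.HasType (if atPre then I₀ else I) o c}

/-- The objects reached from `S` by one navigation step. -/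
def NavStep.eval (I₀ I : InfoBase) (S : Set ℕ) (s : NavStep) : Set ℕ :=
  {o' | ∃ o ∈ S, (if s.role.toIm then Fact.link s.role.assoc o o' else Fact.link s.role.assoc o' o)
    ∈ (if s.atPre then I₀ else I)}

def Path.eval (M : ClassDiagram) (I₀ I : InfoBase) (ρ : ℕ → Option ℕ) (p : Path) : Set ℕ :=
  p.steps.foldl (NavStep.eval I₀ I) (p.source.eval M I₀ I ρ)

def ValExpr.eval (M : ClassDiagram) (I₀ I : InfoBase) (π ρ : ℕ → Option ℕ) : ValExpr → Set ℕ
  | .const v => {v}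
  | .param i => {v | π i = some v}
  | .attr p a atPre =>
    {v | ∃ o ∈ p.eval M I₀ I ρ, Fact.val a o v ∈ (if atPre then I₀ else I)}

/-- Truth of an OCL expression; `π` gives the input parameters, `ρ` the object variables. -/
def OCL.Holds (M : ClassDiagram) (I₀ I : InfoBase) (π : ℕ → Option ℕ) :
    OCL → (ℕ → Option ℕ) → Prop
  | .tt, _ => True
  | .isEmpty p, ρ => p.eval M I₀ I ρ = ∅
  | .includesAll p q, ρ => q.eval M I₀ I ρ ⊆ p.eval M I₀ I ρ
  | .valIncludesAll s t, ρ => t.eval M I₀ I π ρ ⊆ s.eval M I₀ I π ρ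
  | .oclIsNew x, ρ => ∃ o, ρ x = some o ∧ I.Exists o ∧ ¬ I₀.Exists o
  | .oclIsTypeOf x c, ρ => ∃ o, ρ x = some o ∧ Fact.inst o c ∈ I
  | .oclIsKindOf x c, ρ => ∃ o, ρ x = some o ∧ M.HasType I o c
  | .not φ, ρ => ¬ φ.Holds M I₀ I π ρ
  | .and φ ψ, ρ => φ.Holds M I₀ I π ρ ∧ ψ.Holds M I₀ I π ρ
  | .or φ ψ, ρ => φ.Holds M I₀ I π ρ ∨ ψ.Holds M I₀ I π ρ
  | .exists_ p x φ, ρ => ∃ o ∈ p.eval M I₀ I ρ, φ.Holds M I₀ I π (Function.update ρ x (some o))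
  | .forAll p x φ, ρ => ∀ o ∈ p.eval M I₀ I ρ, φ.Holds M I₀ I π (Function.update ρ x (some o))

/-! Well-formedness of expressions: names exist, variables are in scope, `@pre` and `oclIsNew`
occur only in postconditions (`post`), input parameters only in operations (`op`). -/

def Source.Ok (M : ClassDiagram) (post : Bool) (scope : List ℕ) : Source → Prop
  | .var x => x ∈ scope
  | .allInstances c atPre => c < M.numClasses ∧ (atPre = true → post = true)

def Path.Ok (M : ClassDiagram) (post : Bool) (scope : List ℕ) (p : Path) : Prop :=
  p.source.Ok M post scope ∧
    ∀ s ∈ p.steps, s.role.assoc < M.assocs.length ∧ (s.atPre = true → post = true)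

def ValExpr.Ok (M : ClassDiagram) (op post : Bool) (scope : List ℕ) : ValExpr → Prop
  | .const _ => True
  | .param _ => op = true
  | .attr p a atPre => p.Ok M post scope ∧ a < M.attrs.length ∧ (atPre = true → post = true)

def OCL.Ok (M : ClassDiagram) (op post : Bool) : OCL → List ℕ → Prop
  | .tt, _ => True
  | .isEmpty p, sc => p.Ok M post sc
  | .includesAll p q, sc => p.Ok M post sc ∧ q.Ok M post sc
  | .valIncludesAll s t, sc => s.Ok M op post sc ∧ t.Ok M op post sc
  | .oclIsNew x, sc => x ∈ sc ∧ post = true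
  | .oclIsTypeOf x c, sc => x ∈ sc ∧ c < M.numClasses
  | .oclIsKindOf x c, sc => x ∈ sc ∧ c < M.numClasses
  | .not φ, sc => φ.Ok M op post sc
  | .and φ ψ, sc => φ.Ok M op post sc ∧ ψ.Ok M op post sc
  | .or φ ψ, sc => φ.Ok M op post sc ∧ ψ.Ok M op post sc
  | .exists_ p x φ, sc => p.Ok M post sc ∧ φ.Ok M op post (x :: sc)
  | .forAll p x φ, sc => p.Ok M post sc ∧ φ.Ok M op post (x :: sc)

/-! Navigational expressions: every path starts from a variable (the artifact instance or a
variable of the expression), or uses only read-only names. -/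

def Path.Navigational (M : ClassDiagram) (p : Path) : Prop :=
  match p.source with
  | .var _ => True
  | .allInstances c _ => c ∈ M.roClasses ∧ ∀ s ∈ p.steps, s.role.assoc ∈ M.roAssocs

def ValExpr.Navigational (M : ClassDiagram) : ValExpr → Prop
  | .const _ => True
  | .param _ => True
  | .attr p a _ =>
    match p.source with
    | .var _ => True
    | .allInstances _ _ => p.Navigational M ∧ M.ROAttr a

def OCL.Navigational (M : ClassDiagram) : OCL → Prop
  | .tt => True
  | .isEmpty p => p.Navigational M
  | .includesAll p q => p.Navigational M ∧ q.Navigational M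
  | .valIncludesAll s t => s.Navigational M ∧ t.Navigational M
  | .oclIsNew _ => True
  | .oclIsTypeOf _ _ => True
  | .oclIsKindOf _ _ => True
  | .not φ => φ.Navigational M
  | .and φ ψ => φ.Navigational M ∧ ψ.Navigational M
  | .or φ ψ => φ.Navigational M ∧ ψ.Navigational M
  | .exists_ p _ φ => p.Navigational M ∧ φ.Navigational M
  | .forAll p _ φ => p.Navigational M ∧ φ.Navigational M

/-! The expression mentions the role `r`. -/

def Path.Mentions (r : Role) (p : Path) : Prop := ∃ s ∈ p.steps, s.role = r

def ValExpr.Mentions (r : Role) : ValExpr → Prop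
  | .const _ => False
  | .param _ => False
  | .attr p _ _ => p.Mentions r

def OCL.Mentions (r : Role) : OCL → Prop
  | .tt => False
  | .isEmpty p => p.Mentions r
  | .includesAll p q => p.Mentions r ∨ q.Mentions r
  | .valIncludesAll s t => s.Mentions r ∨ t.Mentions r
  | .oclIsNew _ => False
  | .oclIsTypeOf _ _ => False
  | .oclIsKindOf _ _ => False
  | .not φ => φ.Mentions r
  | .and φ ψ => φ.Mentions r ∨ ψ.Mentions r
  | .or φ ψ => φ.Mentions r ∨ ψ.Mentions r
  | .exists_ p _ φ => p.Mentions r ∨ φ.Mentions r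
  | .forAll p _ φ => p.Mentions r ∨ φ.Mentions r

/-! ### Tasks, activity diagrams, state transition diagrams, models -/

/-- An atomic task with its operation contract. Variable `0` is the artifact instance taken in
input. A task with `creates` is an `init` operation: it takes no artifact instance in input but
returns a new one, and variable `0` in its postcondition is `result`. -/
structure Task where
  creates : Bool
  pre : OCL
  post : OCL

inductive Node
  | initial
  | final
  | action (t : Task)
  | decision
  | merge
  | fork
  | join

/-- A control-flow edge; the guard is used on the edges that leave a decision node. -/
structure Edge where
  src : ℕ
  tgt : ℕ
  guard : OCL

structure Activity where
  nodes : List Node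
  edges : List Edge

/-- A transition of a state transition diagram; `source = none` for an initial transition. -/
structure Transition where
  source : Option ℕ
  event : ℕ
  cond : OCL
  target : ℕ

/-- An artifact class with its state transition diagram: the states are the leaves of the hierarchy
below `cls`, the events are the positions in `activities`, which gives the activity diagram of each
event. `final` is the proper termination state. -/
structure Artifact where
  cls : ℕ
  initial : ℕ
  final : ℕ
  transitions : List Transition
  activities : List Activity

structure Model where
  diagram : ClassDiagram
  constraints : List OCL
  artifacts : List Artifact

/-- The (positions of) edges that enter node `n`. -/
def Activity.inEdges (a : Activity) (n : ℕ) : List ℕ :=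
  (List.range a.edges.length).filter fun e => (a.edges[e]?.map Edge.tgt) = some n

/-- The (positions of) edges that leave node `n`. -/
def Activity.outEdges (a : Activity) (n : ℕ) : List ℕ :=
  (List.range a.edges.length).filter fun e => (a.edges[e]?.map Edge.src) = some n

def Activity.HasTask (a : Activity) (t : Task) : Prop := Node.action t ∈ a.nodes

/-- Restrictions on the numbers of edges that enter and leave a node. -/
def Node.DegreesOk (ins outs : List ℕ) : Node → Prop
  | .initial => ins = [] ∧ outs ≠ []
  | .final => ins ≠ [] ∧ outs = []
  | .action _ => ins ≠ []
  | .decision => ins.length = 1 ∧ outs ≠ []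
  | .merge => ins ≠ [] ∧ outs.length = 1
  | .fork => ins.length = 1 ∧ outs ≠ []
  | .join => ins ≠ [] ∧ outs.length = 1

structure Activity.WellFormed (M : ClassDiagram) (a : Activity) : Prop where
  edge_ends : ∀ e ∈ a.edges, e.src < a.nodes.length ∧ e.tgt < a.nodes.length
  initial_unique : ∃! n : ℕ, a.nodes[n]? = some Node.initial
  degrees : ∀ (n : ℕ) (k : Node), a.nodes[n]? = some k → k.DegreesOk (a.inEdges n) (a.outEdges n)
  guards : ∀ e ∈ a.edges, a.nodes[e.src]? ≠ some Node.decision → e.guard = OCL.tt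
  guard_ok : ∀ e ∈ a.edges, e.guard.Ok M false false [0]
  task_ok : ∀ t, a.HasTask t →
    t.pre.Ok M true false (if t.creates then [] else [0]) ∧ t.post.Ok M true true [0]

/-- `c` is a state of the artifact: a leaf of the hierarchy with top class `A.cls`. -/
def Artifact.IsState (M : ClassDiagram) (A : Artifact) (c : ℕ) : Prop :=
  M.Sub c A.cls ∧ M.IsLeaf c

structure Artifact.WellFormed (M : ClassDiagram) (A : Artifact) : Prop where
  cls_valid : A.cls < M.numClasses
  cls_top : ∀ d, (A.cls, d) ∉ M.isa
  cls_rw : ∀ c, M.Sub c A.cls → c ∉ M.roClasses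
  initial_state : A.IsState M A.initial
  final_state : A.IsState M A.final
  trans_states : ∀ t ∈ A.transitions, A.IsState M t.target ∧
    (∀ v, t.source = some v → A.IsState M v) ∧ (t.source = none → t.target = A.initial)
  trans_event : ∀ t ∈ A.transitions, t.event < A.activities.length
  trans_cond : ∀ t ∈ A.transitions, t.cond.Ok M false false (if t.source = none then [] else [0])
  trans_creates : ∀ t ∈ A.transitions, t.source ≠ none →
    ∀ P, A.activities[t.event]? = some P → ∀ k, P.HasTask k → k.creates = false
  activity_ok : ∀ P ∈ A.activities, P.WellFormed M

structure Model.WellFormed (B : Model) : Prop where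
  isa_valid : ∀ p ∈ B.diagram.isa, p.1 < B.diagram.numClasses ∧ p.2 < B.diagram.numClasses
  isa_acyclic : ∀ c, ¬ Relation.TransGen (fun c d => (c, d) ∈ B.diagram.isa) c c
  assoc_valid : ∀ a ∈ B.diagram.assocs, a.dom < B.diagram.numClasses ∧ a.im < B.diagram.numClasses
  attr_valid : ∀ a ∈ B.diagram.attrs, a.owner < B.diagram.numClasses
  constraint_ok : ∀ φ ∈ B.constraints, φ.Ok B.diagram false false []
  artifact_ok : ∀ A ∈ B.artifacts, A.WellFormed B.diagram
  artifact_disjoint : ∀ (i j : ℕ) (A A' : Artifact), B.artifacts[i]? = some A →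
    B.artifacts[j]? = some A' →
    ∀ c, B.diagram.Sub c A.cls → B.diagram.Sub c A'.cls → i = j

/-! ### Navigational and unidirectional models -/

/-- `t` is a task of the model. -/
def Model.HasTask (B : Model) (t : Task) : Prop :=
  ∃ A ∈ B.artifacts, ∃ P ∈ A.activities, P.HasTask t

/-- `φ` is a condition of the model: on a transition, or a guard in an activity diagram. -/
def Model.HasCond (B : Model) (φ : OCL) : Prop :=
  ∃ A ∈ B.artifacts, (∃ t ∈ A.transitions, t.cond = φ) ∨
    ∃ P ∈ A.activities, ∃ e ∈ P.edges, e.guard = φ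

/-- `φ` is one of the OCL expressions of the model. -/
def Model.HasExpr (B : Model) (φ : OCL) : Prop :=
  φ ∈ B.constraints ∨ B.HasCond φ ∨ ∃ t, B.HasTask t ∧ (t.pre = φ ∨ t.post = φ)

/-- All conditions, and the contracts of all tasks except the `init` operations, are
navigational. -/
def Model.Navigational (B : Model) : Prop :=
  (∀ t, B.HasTask t → t.creates = false →
    t.pre.Navigational B.diagram ∧ t.post.Navigational B.diagram) ∧
  ∀ φ, B.HasCond φ → φ.Navigational B.diagram

/-- A target role: some OCL expression of the model mentions it. -/
def Model.Target (B : Model) (r : Role) : Prop := ∃ φ, B.HasExpr φ ∧ φ.Mentions r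

/-- Some association connects `c` and `d`, and its role attached to `d` is a target role. -/
def Model.DependsStep (B : Model) (c d : ℕ) : Prop :=
  ∃ r a, B.diagram.assocs[r]? = some a ∧
    ((a.dom = c ∧ a.im = d ∧ B.Target ⟨r, true⟩) ∨ (a.im = c ∧ a.dom = d ∧ B.Target ⟨r, false⟩))

/-- `B.DependsOn d c`: the class `d` depends on the class `c`. -/
def Model.DependsOn (B : Model) (d c : ℕ) : Prop := Relation.TransGen B.DependsStep c d

/-- The model is navigational and no read-write class depends on itself or on one of its
super- or subclasses. -/
def Model.Unidirectional (B : Model) : Prop :=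
  B.Navigational ∧ ∀ c, c < B.diagram.numClasses → c ∉ B.diagram.roClasses →
    ∀ d, (B.diagram.Sub c d ∨ B.diagram.Sub d c) → ¬ B.DependsOn c d

/-! ### Execution semantics -/

/-- No parameters, respectively no variables, have a value. -/
def noVal : ℕ → Option ℕ := fun _ => none

/-- The variable assignment in which variable `0` is the artifact instance in scope, if any. -/
def selfEnv (self : Option ℕ) : ℕ → Option ℕ := Function.update noVal 0 self

/-- Truth of a condition in `I`, for the artifact instance `self` in scope. -/
def OCL.CondHolds (M : ClassDiagram) (I : InfoBase) (self : Option ℕ) (φ : OCL) : Prop :=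
  φ.Holds M I I noVal (selfEnv self)

/-- Legal information bases: instances of the class diagram in which every artifact instance is in
one of its states and all OCL constraints hold. -/
def Model.Legal (B : Model) (I : InfoBase) : Prop :=
  B.diagram.IsInstance I ∧
  (∀ A ∈ B.artifacts, ∀ o c, Fact.inst o c ∈ I → B.diagram.Sub c A.cls → A.IsState B.diagram c) ∧
  ∀ φ ∈ B.constraints, φ.CondHolds B.diagram I none

/-- `J` is a legal information base with the same read-only part as `I`, and the postcondition of
`t` holds for the passage from `I` to `J`; `self'` is the artifact instance in input or, if `t`
creates an instance of `A`, the new instance. -/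
def Task.Admissible (B : Model) (A : Artifact) (t : Task) (π : ℕ → ℕ) (self' : Option ℕ)
    (I J : InfoBase) : Prop :=
  B.Legal J ∧
  (∀ f, B.diagram.ROFact f → (f ∈ I ↔ f ∈ J)) ∧
  t.post.Holds B.diagram I J (fun i => some (π i)) (selfEnv self') ∧
  (t.creates = true → ∃ o, self' = some o ∧ ¬ I.Exists o ∧ B.diagram.HasType J o A.cls)

/-- Execution of a task, with input parameters `π`: the artifact instance in input (if any) is an
instance of `A`, the precondition holds in `I`, and `J` is
obtained from `I` by a minimal (with respect to inclusion) set of insertions and deletions of facts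
that makes the postcondition true; that is, whatever the postcondition does not require to change
stays as it is. -/
def Task.Exec (B : Model) (A : Artifact) (t : Task) (self self' : Option ℕ)
    (I J : InfoBase) : Prop :=
  (if t.creates = true then self = none else self' = self) ∧
  (∀ o, self = some o → B.diagram.HasType I o A.cls) ∧
  ∃ π : ℕ → ℕ,
    t.pre.Holds B.diagram I I (fun i => some (π i)) (selfEnv self) ∧
    t.Admissible B A π self' I J ∧
    ∀ K, t.Admissible B A π self' I K → symmDiff I K ⊆ symmDiff I J → K = J

/-- A running activity diagram: the artifact type and the transition being taken (as positions in
the lists), the artifact instance (`none` before it has been created), and the tokens, which lie on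
the edges of the activity diagram. -/
structure Proc where
  art : ℕ
  trans : ℕ
  self : Option ℕ
  tokens : Multiset ℕ

/-- A state of the system. -/
structure Config where
  ib : InfoBase
  procs : Multiset Proc

/-- Node `n`, of kind `k`, consumes the tokens `c`. -/
def Node.Consumes (P : Activity) (n : ℕ) (c : Multiset ℕ) : Node → Prop
  | .initial => False
  | .final => False
  | .merge => ∃ e ∈ P.inEdges n, c = {e}
  | _ => c = (P.inEdges n : Multiset ℕ)

/-- Node `n`, of kind `k`, produces the tokens `c`. -/
def Node.Produces (M : ClassDiagram) (P : Activity) (I : InfoBase) (self : Option ℕ) (n : ℕ)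
    (c : Multiset ℕ) : Node → Prop
  | .decision => ∃ e ∈ P.outEdges n, c = {e} ∧
      ∃ g, P.edges[e]? = some g ∧ g.guard.CondHolds M I self
  | _ => c = (P.outEdges n : Multiset ℕ)

/-- The effect of a node on the information base and the artifact instance in scope. -/
def Node.Effect (B : Model) (A : Artifact) (self self' : Option ℕ) (I J : InfoBase) : Node → Prop
  | .action t => t.Exec B A self self' I J
  | _ => self' = self ∧ J = I

/-- Steps of the system: artifact instances evolve concurrently, by interleaving. -/
inductive Model.Step (B : Model) : Config → Config → Prop
  /-- An event triggers a transition: an initial one, or one that leaves the current state of an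
  artifact instance which is not running an activity. -/
  | start (I : InfoBase) (ps : Multiset Proc) (i k : ℕ) (A : Artifact) (t : Transition)
      (P : Activity) (n : ℕ) (self : Option ℕ)
      (hA : B.artifacts[i]? = some A) (ht : A.transitions[k]? = some t)
      (hP : A.activities[t.event]? = some P) (hn : P.nodes[n]? = some Node.initial)
      (hself : (t.source = none ∧ self = none) ∨
        ∃ v o, t.source = some v ∧ self = some o ∧ Fact.inst o v ∈ I ∧ ∀ q ∈ ps, q.self ≠ some o)
      (hcond : t.cond.CondHolds B.diagram I self) :
      Model.Step B ⟨I, ps⟩ ⟨I, ⟨i, k, self, (P.outEdges n : Multiset ℕ)⟩ ::ₘ ps⟩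
  /-- A node of a running activity diagram fires; an artifact instance runs at most one activity. -/
  | fire (I J : InfoBase) (ps : Multiset Proc) (i k : ℕ) (A : Artifact) (t : Transition)
      (P : Activity) (n : ℕ) (nd : Node) (self self' : Option ℕ) (rest c d : Multiset ℕ)
      (hA : B.artifacts[i]? = some A) (ht : A.transitions[k]? = some t)
      (hP : A.activities[t.event]? = some P) (hn : P.nodes[n]? = some nd)
      (hc : nd.Consumes P n c) (hd : nd.Produces B.diagram P I self n d)
      (he : nd.Effect B A self self' I J) (hps : ∀ q ∈ ps, ∀ o, self' = some o → q.self ≠ some o) :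
      Model.Step B ⟨I, ⟨i, k, self, rest + c⟩ ::ₘ ps⟩ ⟨J, ⟨i, k, self', rest + d⟩ ::ₘ ps⟩
  /-- A running activity diagram ends when a token reaches a final node and the artifact instance
  is in the target state of the transition. -/
  | finish (I : InfoBase) (ps : Multiset Proc) (i k : ℕ) (A : Artifact) (t : Transition)
      (P : Activity) (n o e : ℕ) (tokens : Multiset ℕ)
      (hA : B.artifacts[i]? = some A) (ht : A.transitions[k]? = some t)
      (hP : A.activities[t.event]? = some P) (hn : P.nodes[n]? = some Node.final)
      (he : e ∈ P.inEdges n) (htok : e ∈ tokens) (htarget : Fact.inst o t.target ∈ I) :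
      Model.Step B ⟨I, ⟨i, k, some o, tokens⟩ ::ₘ ps⟩ ⟨I, ps⟩

/-! ### Artifact termination -/

/-- `⟨-⟩Y`. -/
def Model.Diamond (B : Model) (Y : Set Config) : Set Config := {s | ∃ s', B.Step s s' ∧ s' ∈ Y}

/-- `[-]Z`. -/
def Model.Box (B : Model) (Z : Set Config) : Set Config := {s | ∀ s', B.Step s s' → s' ∈ Z}

/-- The operator `Y ↦ t_A(x) ∨ (A(x) ∧ ⟨-⟩Y)`, with `t_A` the termination state of `A`. -/
def Model.reachOp (B : Model) (A : Artifact) (x : ℕ) : Set Config →o Set Config where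
  toFun Y := {s | B.diagram.HasType s.ib x A.final ∨
    (B.diagram.HasType s.ib x A.cls ∧ s ∈ B.Diamond Y)}
  monotone' := by
    rintro Y Y' h s (hs | ⟨hs, s', hst, hs'⟩)
    · exact Or.inl hs
    · exact Or.inr ⟨hs, s', hst, h hs'⟩

/-- The operator `Z ↦ (⋀_A ∀x. A(x) → μY. t_A(x) ∨ (A(x) ∧ ⟨-⟩Y)) ∧ [-]Z`. -/
def Model.terminationOp (B : Model) : Set Config →o Set Config where
  toFun Z := {s | (∀ A ∈ B.artifacts, ∀ x, B.diagram.HasType s.ib x A.cls →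
    s ∈ OrderHom.lfp (B.reachOp A x)) ∧ s ∈ B.Box Z}
  monotone' := fun _ _ h _ hs => ⟨hs.1, fun s' hst => h (hs.2 s' hst)⟩

/-- The artifact termination property `νZ. (⋀_A ∀x. A(x) → μY. t_A(x) ∨ (A(x) ∧ ⟨-⟩Y)) ∧ [-]Z`
holds in the initial state given by the initial information base `D` (nothing is running). -/
def Model.Terminates (B : Model) (D : InfoBase) : Prop :=
  (⟨D, 0⟩ : Config) ∈ OrderHom.gfp B.terminationOp

/-! ### Codes of models

An injective numbering of models, built from Mathlib's standard codings of pairs, options and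
lists, so that a model can be the input of a computable function. -/

open Encodable

def Multiplicity.code (m : Multiplicity) : ℕ := encode (m.lower, m.upper)

def Assoc.code (a : Assoc) : ℕ := encode (a.dom, a.im, a.domMult.code, a.imMult.code)

def Attr.code (a : Attr) : ℕ := encode (a.owner, a.required)

def ClassDiagram.code (M : ClassDiagram) : ℕ :=
  encode (M.numClasses, M.isa, M.assocs.map Assoc.code, M.attrs.map Attr.code, M.roClasses,
    M.roAssocs)

def NavStep.code (s : NavStep) : ℕ := encode (s.role.assoc, s.role.toIm, s.atPre)

def Source.code : Source → ℕ
  | .var x => encode (0, x)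
  | .allInstances c b => encode (1, encode (c, b))

def Path.code (p : Path) : ℕ := encode (p.source.code, p.steps.map NavStep.code)

def ValExpr.code : ValExpr → ℕ
  | .const v => encode (0, v)
  | .param i => encode (1, i)
  | .attr p a b => encode (2, encode (p.code, a, b))

def OCL.code : OCL → ℕ
  | .tt => encode (0, 0)
  | .isEmpty p => encode (1, p.code)
  | .includesAll p q => encode (2, encode (p.code, q.code))
  | .valIncludesAll s t => encode (3, encode (s.code, t.code))
  | .oclIsNew x => encode (4, x)
  | .oclIsTypeOf x c => encode (5, encode (x, c))
  | .oclIsKindOf x c => encode (6, encode (x, c))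
  | .not φ => encode (7, φ.code)
  | .and φ ψ => encode (8, encode (φ.code, ψ.code))
  | .or φ ψ => encode (9, encode (φ.code, ψ.code))
  | .exists_ p x φ => encode (10, encode (p.code, x, φ.code))
  | .forAll p x φ => encode (11, encode (p.code, x, φ.code))

def Task.code (t : Task) : ℕ := encode (t.creates, t.pre.code, t.post.code)

def Node.code : Node → ℕ
  | .initial => encode (0, 0)
  | .final => encode (1, 0)
  | .action t => encode (2, t.code)
  | .decision => encode (3, 0)
  | .merge => encode (4, 0)
  | .fork => encode (5, 0)
  | .join => encode (6, 0)

def Edge.code (e : Edge) : ℕ := encode (e.src, e.tgt, e.guard.code)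

def Activity.code (a : Activity) : ℕ := encode (a.nodes.map Node.code, a.edges.map Edge.code)

def Transition.code (t : Transition) : ℕ := encode (t.source, t.event, t.cond.code, t.target)

def Artifact.code (A : Artifact) : ℕ :=
  encode (A.cls, A.initial, A.final, A.transitions.map Transition.code,
    A.activities.map Activity.code)

def Model.code (B : Model) : ℕ :=
  encode (B.diagram.code, B.constraints.map OCL.code, B.artifacts.map Artifact.code)

theorem Multiplicity.code_injective : Function.Injective Multiplicity.code := by
  rintro ⟨⟩ ⟨⟩ h
  have h := encode_injective h
  simp_all

theorem Assoc.code_injective : Function.Injective Assoc.code := by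
  rintro ⟨⟩ ⟨⟩ h
  have h := encode_injective h
  simp_all [Multiplicity.code_injective.eq_iff]

theorem Attr.code_injective : Function.Injective Attr.code := by
  rintro ⟨⟩ ⟨⟩ h
  have h := encode_injective h
  simp_all

theorem ClassDiagram.code_injective : Function.Injective ClassDiagram.code := by
  rintro ⟨⟩ ⟨⟩ h
  have h := encode_injective h
  simp_all [(List.map_injective_iff.2 Assoc.code_injective).eq_iff,
    (List.map_injective_iff.2 Attr.code_injective).eq_iff]

theorem NavStep.code_injective : Function.Injective NavStep.code := by
  rintro ⟨⟨⟩, _⟩ ⟨⟨⟩, _⟩ h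
  have h := encode_injective h
  simp_all

theorem Source.code_injective : Function.Injective Source.code := by
  rintro (_ | _) (_ | _) h <;> have h := encode_injective h <;> simp_all

theorem Path.code_injective : Function.Injective Path.code := by
  rintro ⟨⟩ ⟨⟩ h
  have h := encode_injective h
  simp_all [Source.code_injective.eq_iff,
    (List.map_injective_iff.2 NavStep.code_injective).eq_iff]

theorem ValExpr.code_injective : Function.Injective ValExpr.code := by
  rintro (_ | _ | _) (_ | _ | _) h <;> have h := encode_injective h <;>
    simp_all [Path.code_injective.eq_iff]

theorem OCL.code_injective : Function.Injective OCL.code := by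
  intro φ
  induction φ <;> rintro (_ | _ | _ | _ | _ | _ | _ | _ | _ | _ | _ | _) h <;>
    have h := encode_injective h <;>
    simp only [Prod.mk.injEq, encode_inj, Path.code_injective.eq_iff,
      ValExpr.code_injective.eq_iff] at h <;> grind

theorem Task.code_injective : Function.Injective Task.code := by
  rintro ⟨⟩ ⟨⟩ h
  have h := encode_injective h
  simp_all [OCL.code_injective.eq_iff]

theorem Node.code_injective : Function.Injective Node.code := by
  rintro (_ | _ | _ | _ | _ | _ | _) (_ | _ | _ | _ | _ | _ | _) h <;>
    have h := encode_injective h <;> simp_all [Task.code_injective.eq_iff]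

theorem Edge.code_injective : Function.Injective Edge.code := by
  rintro ⟨⟩ ⟨⟩ h
  have h := encode_injective h
  simp_all [OCL.code_injective.eq_iff]

theorem Activity.code_injective : Function.Injective Activity.code := by
  rintro ⟨⟩ ⟨⟩ h
  have h := encode_injective h
  simp_all [(List.map_injective_iff.2 Node.code_injective).eq_iff,
    (List.map_injective_iff.2 Edge.code_injective).eq_iff]

theorem Transition.code_injective : Function.Injective Transition.code := by
  rintro ⟨⟩ ⟨⟩ h
  have h := encode_injective h
  simp_all [OCL.code_injective.eq_iff]

theorem Artifact.code_injective : Function.Injective Artifact.code := by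
  rintro ⟨⟩ ⟨⟩ h
  have h := encode_injective h
  simp_all [(List.map_injective_iff.2 Transition.code_injective).eq_iff,
    (List.map_injective_iff.2 Activity.code_injective).eq_iff]

theorem Model.code_injective : Function.Injective Model.code := by
  rintro ⟨⟩ ⟨⟩ h
  have h := encode_injective h
  simp_all [ClassDiagram.code_injective.eq_iff,
    (List.map_injective_iff.2 OCL.code_injective).eq_iff,
    (List.map_injective_iff.2 Artifact.code_injective).eq_iff]

end BAUML

/-!
The domain of a partial recursive function is reduced to artifact termination. The function is
written as a Horn program over the natural numbers, and the read-write classes of the model store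
the steps of a derivation, together with pairs of values that are to order the ranks of the steps.
As soon as an artifact instance is terminated, the constraints demand that the stored steps derive
from rules of the program and instances of the successor relation that the function takes a value
at `n`.

Data values are unordered and the only constants are those of the model, so neither the order nor
the successor relation on the stored values can be prescribed. But the pairs of a finite
information base form a well-founded relation once they are transitive and irreflexive, so every
derivation is well founded and the successor steps, which are injective, avoid zero and agree with
the pairs, are intended ones after the values are renamed to their heights. Requiring
`0, 1, …, n` to be chained by successor steps makes the renaming fix them. Conversely, the task that
terminates an instance may insert any derivation that exists, and can be repeated when
another task has moved the instance back.
-/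

namespace BAUML

open Nat.Partrec (Code)
open Nat.Partrec.Code (evaln evaln_sound evaln_complete evaln_mono evaln_bound)

/-! ### Horn programs -/

/-- An atom of a Horn program with ternary predicates, named by `tag`; its arguments are variables
in a rule, and numbers if it is ground. -/
@[ext]
structure Atom (α : Type) where
  tag : ℕ
  x : α
  y : α
  z : α
  deriving DecidableEq, Encodable

namespace Atom

variable {α β : Type}

/-- The atom `a` with its arguments replaced by their images under `σ`. -/
def map (σ : α → β) (a : Atom α) : Atom β := ⟨a.tag, σ a.x, σ a.y, σ a.z⟩

/-- The atom `y = x + 1`. Like in all atoms for binary predicates, the last argument is repeated. -/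
def succ (x y : α) : Atom α := ⟨0, x, y, y⟩

/-- The atom `x ≤ y`. -/
def le (x y : α) : Atom α := ⟨1, x, y, y⟩

/-- The atom `z = x + y`. -/
def add (x y z : α) : Atom α := ⟨2, x, y, z⟩

/-- The atom `z = x * y`. -/
def mul (x y z : α) : Atom α := ⟨3, x, y, z⟩

/-- The atom `z = Nat.pair x y`. -/
def pair (x y z : α) : Atom α := ⟨4, x, y, z⟩

/-- The atom `y ∈ c.eval x`. The tags below `5` are those of the arithmetical predicates. -/
def graph (c : Code) (x y : α) : Atom α := ⟨c.encodeCode + 5, x, y, y⟩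

end Atom

/-- A Horn rule in the variables `0, …, 9`. No rule defines predicate `0`, which always stands for
the successor relation. -/
structure Rule where
  head : Atom (Fin 10)
  prems : List (Atom (Fin 10))
  head_tag_ne : head.tag ≠ 0 := by exact Nat.succ_ne_zero _

/-- The ground atoms derivable from a Horn program. Variable `0` stands for the number zero. -/
inductive Derivable (P : List Rule) : Atom ℕ → Prop
  | succ (x z : ℕ) : Derivable P ⟨0, x, x + 1, z⟩
  | rule (r : Rule) (σ : Fin 10 → ℕ) (hr : r ∈ P) (h0 : σ 0 = 0)
      (hp : ∀ a ∈ r.prems, Derivable P (a.map σ)) : Derivable P (r.head.map σ)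

/-- The valuation that gives the variables `1, 2, …` the values in `l`, and `0` to the others. -/
def valuation (l : List ℕ) (i : Fin 10) : ℕ := (0 :: l).getD i 0

theorem Derivable.of_rule {P : List Rule} (r : Rule) (l : List ℕ) {a : Atom ℕ} (hr : r ∈ P)
    (ha : r.head.map (valuation l) = a)
    (hp : (r.prems.map (Atom.map (valuation l))).Forall (Derivable P)) : Derivable P a :=
  ha ▸ .rule r _ hr rfl fun _ hb => List.forall_iff_forall_mem.1 hp _ (List.mem_map_of_mem hb)

/-! ### The Horn program of a partial recursive function -/

/-- Rules for `x ≤ y`, by recursion on `y`. -/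
def leRules : List Rule :=
  [{ head := .le 1 1, prems := [] },
   { head := .le 1 3, prems := [.le 1 2, .succ 2 3] }]

/-- Rules for `x + y`, by recursion on `y`. -/
def addRules : List Rule :=
  [{ head := .add 1 0 1, prems := [] },
   { head := .add 1 4 5, prems := [.add 1 2 3, .succ 2 4, .succ 3 5] }]

/-- Rules for `x * y`, by recursion on `y`. -/
def mulRules : List Rule :=
  [{ head := .mul 1 0 0, prems := [] },
   { head := .mul 1 4 5, prems := [.mul 1 2 3, .succ 2 4, .add 3 1 5] }]

/-- Rules for `Nat.pair x y`, which is `y * y + x` if `x < y`, and `x * x + x + y` otherwise. -/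
def pairRules : List Rule :=
  [{ head := .pair 1 2 5, prems := [.succ 1 3, .le 3 2, .mul 2 2 4, .add 4 1 5] },
   { head := .pair 1 2 5, prems := [.le 2 1, .mul 1 1 3, .add 3 1 4, .add 4 2 5] }]

/-- The rules for the arithmetical predicates, on which the rules for codes rely. -/
def arithmeticRules : List Rule := leRules ++ addRules ++ mulRules ++ pairRules

/-- Rules for the graphs of the code `c` and its subcodes, one or two per constructor. -/
def codeRules : Code → List Rule
  | .zero => [{ head := .graph .zero 1 0, prems := [] }]
  | .succ => [{ head := .graph .succ 1 2, prems := [.succ 1 2] }]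
  | .left => [{ head := .graph .left 3 1, prems := [.pair 1 2 3] }]
  | .right => [{ head := .graph .right 3 2, prems := [.pair 1 2 3] }]
  | .pair f g =>
    { head := .graph (.pair f g) 1 4, prems := [.graph f 1 2, .graph g 1 3, .pair 2 3 4] } ::
      (codeRules f ++ codeRules g)
  | .comp f g =>
    { head := .graph (.comp f g) 1 3, prems := [.graph g 1 2, .graph f 2 3] } ::
      (codeRules f ++ codeRules g)
  | .prec f g =>
    { head := .graph (.prec f g) 2 3, prems := [.pair 1 0 2, .graph f 1 3] } ::
    { head := .graph (.prec f g) 4 9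
      prems := [.pair 1 3 4, .succ 2 3, .pair 1 2 5, .graph (.prec f g) 5 6, .pair 2 6 7,
        .pair 1 7 8, .graph g 8 9] } ::
      (codeRules f ++ codeRules g)
  | .rfind' f =>
    { head := .graph (.rfind' f) 3 2, prems := [.pair 1 2 3, .graph f 3 0] } ::
    { head := .graph (.rfind' f) 3 8
      prems := [.pair 1 2 3, .graph f 3 5, .succ 4 5, .succ 2 6, .pair 1 6 7,
        .graph (.rfind' f) 7 8] } ::
      codeRules f

/-- The Horn program that evaluates the code `c`. -/
def program (c : Code) : List Rule := arithmeticRules ++ codeRules c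

/-! ### Soundness -/

/-- The intended meaning of ground atoms. -/
def Atom.IsTrue : Atom ℕ → Prop
  | ⟨0, x, y, _⟩ => y = x + 1
  | ⟨1, x, y, _⟩ => x ≤ y
  | ⟨2, x, y, z⟩ => z = x + y
  | ⟨3, x, y, z⟩ => z = x * y
  | ⟨4, x, y, z⟩ => z = Nat.pair x y
  | ⟨k + 5, x, y, _⟩ => y ∈ (Code.ofNatCode k).eval x

namespace Atom

variable (σ : Fin 10 → ℕ) (i j k : Fin 10)

theorem isTrue_map_succ : ((succ i j).map σ).IsTrue ↔ σ j = σ i + 1 := Iff.rfl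

theorem isTrue_map_le : ((le i j).map σ).IsTrue ↔ σ i ≤ σ j := Iff.rfl

theorem isTrue_map_add : ((add i j k).map σ).IsTrue ↔ σ k = σ i + σ j := Iff.rfl

theorem isTrue_map_mul : ((mul i j k).map σ).IsTrue ↔ σ k = σ i * σ j := Iff.rfl

theorem isTrue_map_pair : ((pair i j k).map σ).IsTrue ↔ σ k = Nat.pair (σ i) (σ j) := Iff.rfl

theorem isTrue_graph (c : Code) (x y : ℕ) : (graph c x y).IsTrue ↔ y ∈ c.eval x := by
  have hc : Code.ofNatCode c.encodeCode = c := by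
    rw [← Code.encodeCode_eq, ← Code.ofNatCode_eq, Denumerable.ofNat_encode]
  simp only [graph, IsTrue, hc]

theorem isTrue_map_graph (c : Code) : ((graph c i j).map σ).IsTrue ↔ σ j ∈ c.eval (σ i) :=
  isTrue_graph c (σ i) (σ j)

end Atom

/-- The rule derives true atoms from true atoms. -/
def Rule.Sound (r : Rule) : Prop :=
  ∀ σ : Fin 10 → ℕ, σ 0 = 0 → (∀ a ∈ r.prems, (a.map σ).IsTrue) → (r.head.map σ).IsTrue

theorem arithmeticRules_sound : ∀ r ∈ arithmeticRules, r.Sound := by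
  simp only [arithmeticRules, leRules, addRules, mulRules, pairRules, List.forall_mem_append,
    List.forall_mem_cons, List.not_mem_nil, IsEmpty.forall_iff, implies_true, and_true,
    Rule.Sound, Atom.isTrue_map_succ, Atom.isTrue_map_le, Atom.isTrue_map_add, Atom.isTrue_map_mul,
    Atom.isTrue_map_pair, Nat.pair]
  grind

theorem mem_eval_pair {f g : Code} {n y : ℕ} :
    y ∈ (f.pair g).eval n ↔ ∃ a ∈ f.eval n, ∃ b ∈ g.eval n, Nat.pair a b = y := by
  simp [Code.eval, Seq.seq]

theorem mem_eval_comp {f g : Code} {n y : ℕ} :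
    y ∈ (f.comp g).eval n ↔ ∃ a ∈ g.eval n, y ∈ f.eval a := Part.mem_bind_iff

theorem mem_eval_prec_succ {f g : Code} {a m y : ℕ} :
    y ∈ (f.prec g).eval (Nat.pair a (m + 1)) ↔
      ∃ v ∈ (f.prec g).eval (Nat.pair a m), y ∈ g.eval (Nat.pair a (Nat.pair m v)) := by
  rw [Code.eval_prec_succ]
  exact Part.mem_bind_iff

theorem mem_evaln_succ_rfind' {f : Code} {k a m y : ℕ} :
    y ∈ evaln (k + 1) f.rfind' (Nat.pair a m) ↔
      Nat.pair a m ≤ k ∧ ∃ v ∈ evaln (k + 1) f (Nat.pair a m),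
        if v = 0 then y = m else y ∈ evaln k f.rfind' (Nat.pair a (m + 1)) := by
  simp only [evaln, Nat.unpaired, Nat.unpair_pair, Option.mem_def, Option.bind_eq_bind,
    Option.bind_eq_some_iff, Option.guard_eq_some', exists_const]
  grind

theorem mem_eval_rfind'_of_zero_mem {f : Code} {a m : ℕ} (h : 0 ∈ f.eval (Nat.pair a m)) :
    m ∈ f.rfind'.eval (Nat.pair a m) := by
  obtain ⟨_ | k, hk⟩ := evaln_complete.1 h
  · simp [evaln] at hk
  · exact evaln_sound (mem_evaln_succ_rfind'.2 ⟨Nat.lt_succ_iff.1 (evaln_bound hk), 0, hk, rfl⟩)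

theorem mem_eval_rfind'_of_succ_mem {f : Code} {a m v y : ℕ}
    (hv : v + 1 ∈ f.eval (Nat.pair a m)) (hy : y ∈ f.rfind'.eval (Nat.pair a (m + 1))) :
    y ∈ f.rfind'.eval (Nat.pair a m) := by
  obtain ⟨k, hk⟩ := evaln_complete.1 hv
  obtain ⟨l, hl⟩ := evaln_complete.1 hy
  have hbound := evaln_bound hk
  refine evaln_sound (k := max k l + 1) (mem_evaln_succ_rfind'.2 ⟨by omega, v + 1, ?_, ?_⟩)
  · exact evaln_mono (by omega) hk
  · simpa using evaln_mono (le_max_right k l) hl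

theorem codeRules_sound (c : Code) : ∀ r ∈ codeRules c, r.Sound := by
  induction c <;>
    simp only [codeRules, List.forall_mem_append, List.forall_mem_cons, List.not_mem_nil,
      IsEmpty.forall_iff, implies_true, and_true, Rule.Sound, Atom.isTrue_map_succ,
      Atom.isTrue_map_pair, Atom.isTrue_map_graph]
  case zero => simp +contextual [Code.eval, pure, PFun.pure]
  case succ => simp +contextual [Code.eval]
  case left => simp +contextual [Code.eval]
  case right => simp +contextual [Code.eval]
  case pair f g hf hg =>
    refine ⟨?_, hf, hg⟩
    rintro σ - ⟨h₁, h₂, h₃⟩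
    exact mem_eval_pair.2 ⟨_, h₁, _, h₂, h₃.symm⟩
  case comp f g hf hg =>
    refine ⟨?_, hf, hg⟩
    rintro σ - ⟨h₁, h₂⟩
    exact mem_eval_comp.2 ⟨_, h₁, h₂⟩
  case prec f g hf hg =>
    refine ⟨?_, ?_, hf, hg⟩
    · rintro σ h₀ ⟨h₁, h₂⟩
      rwa [h₁, h₀, Code.eval_prec_zero]
    · rintro σ - ⟨h₁, h₂, h₃, h₄, h₅, h₆, h₇⟩
      rw [h₃] at h₄
      rw [h₆, h₅] at h₇
      rw [h₁, h₂]
      exact mem_eval_prec_succ.2 ⟨_, h₄, h₇⟩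
  case rfind' f hf =>
    refine ⟨?_, ?_, hf⟩
    · rintro σ h₀ ⟨h₁, h₂⟩
      rw [h₁, h₀] at h₂
      rw [h₁]
      exact mem_eval_rfind'_of_zero_mem h₂
    · rintro σ - ⟨h₁, h₂, h₃, h₄, h₅, h₆⟩
      rw [h₁, h₃] at h₂
      rw [h₅, h₄] at h₆
      rw [h₁]
      exact mem_eval_rfind'_of_succ_mem h₂ h₆

theorem Derivable.isTrue {c : Code} {a : Atom ℕ} (h : Derivable (program c) a) : a.IsTrue := by
  induction h with
  | succ => rfl
  | rule r σ hr h0 _ ih =>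
    rcases List.mem_append.1 hr with hr | hr
    · exact arithmeticRules_sound r hr σ h0 ih
    · exact codeRules_sound c r hr σ h0 ih

/-! ### Completeness -/

section Completeness

variable {P : List Rule} {f g : Code}

theorem Derivable.le (hP : leRules ⊆ P) {a b : ℕ} (h : a ≤ b) : Derivable P (.le a b) := by
  simp only [leRules, List.cons_subset] at hP
  induction b, h using Nat.le_induction with
  | base => exact .of_rule _ [a] hP.1 rfl trivial
  | succ b _ ih =>
    exact .of_rule _ [a, b, b + 1] hP.2.1 rfl ⟨ih, .succ b (b + 1)⟩

theorem Derivable.add (hP : addRules ⊆ P) (a b : ℕ) : Derivable P (.add a b (a + b)) := by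
  simp only [addRules, List.cons_subset] at hP
  induction b with
  | zero => exact .of_rule _ [a] hP.1 rfl trivial
  | succ b ih =>
    exact .of_rule _ [a, b, a + b, b + 1, a + b + 1] hP.2.1 rfl
      ⟨ih, .succ b (b + 1), .succ (a + b) (a + b + 1)⟩

theorem Derivable.mul (hadd : addRules ⊆ P) (hP : mulRules ⊆ P) (a b : ℕ) :
    Derivable P (.mul a b (a * b)) := by
  simp only [mulRules, List.cons_subset] at hP
  induction b with
  | zero => exact .of_rule _ [a] hP.1 rfl trivial
  | succ b ih =>
    exact .of_rule _ [a, b, a * b, b + 1, a * b + a] hP.2.1 rfl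
      ⟨ih, .succ b (b + 1), .add hadd (a * b) a⟩

theorem Derivable.pair (hP : arithmeticRules ⊆ P) (a b : ℕ) :
    Derivable P (.pair a b (Nat.pair a b)) := by
  simp only [arithmeticRules, pairRules, List.append_subset, List.cons_subset] at hP
  obtain ⟨⟨⟨hle, hadd⟩, hmul⟩, hlt, hge, -⟩ := hP
  rcases lt_or_ge a b with h | h
  · rw [Nat.pair, if_pos h]
    exact .of_rule _ [a, b, a + 1, b * b, b * b + a] hlt rfl
      ⟨.succ a (a + 1), .le hle h, .mul hadd hmul b b, .add hadd (b * b) a⟩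
  · rw [Nat.pair, if_neg h.not_gt]
    exact .of_rule _ [a, b, a * a, a * a + a, a * a + a + b] hge rfl
      ⟨.le hle h, .mul hadd hmul a a, .add hadd (a * a) a, .add hadd (a * a + a) b⟩

/-- The program `P` derives the graph of the function with code `c`. -/
def Computes (P : List Rule) (c : Code) : Prop :=
  ∀ n m, m ∈ c.eval n → Derivable P (.graph c n m)

theorem computes_zero (hP : codeRules .zero ⊆ P) : Computes P .zero := by
  intro n m h
  obtain rfl : m = 0 := by simpa [Code.eval, pure, PFun.pure] using h
  exact .of_rule _ [n] (hP (List.mem_singleton_self _)) rfl trivial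

theorem computes_succ (hP : codeRules .succ ⊆ P) : Computes P .succ := by
  intro n m h
  obtain rfl : m = n + 1 := by simpa [Code.eval] using h
  exact .of_rule _ [n, n + 1] (hP (List.mem_singleton_self _)) rfl (Derivable.succ n (n + 1))

theorem computes_left (harith : arithmeticRules ⊆ P) (hP : codeRules .left ⊆ P) :
    Computes P .left := by
  intro n m h
  obtain ⟨a, b, rfl⟩ : ∃ a b, n = Nat.pair a b := ⟨_, _, (Nat.pair_unpair n).symm⟩
  obtain rfl : m = a := by simpa [Code.eval] using h
  exact .of_rule _ [m, b, Nat.pair m b] (hP (List.mem_singleton_self _)) rfl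
    (Derivable.pair harith m b)

theorem computes_right (harith : arithmeticRules ⊆ P) (hP : codeRules .right ⊆ P) :
    Computes P .right := by
  intro n m h
  obtain ⟨a, b, rfl⟩ : ∃ a b, n = Nat.pair a b := ⟨_, _, (Nat.pair_unpair n).symm⟩
  obtain rfl : m = b := by simpa [Code.eval] using h
  exact .of_rule _ [a, m, Nat.pair a m] (hP (List.mem_singleton_self _)) rfl
    (Derivable.pair harith a m)

theorem Computes.pair (harith : arithmeticRules ⊆ P) (hP : codeRules (.pair f g) ⊆ P)
    (hf : Computes P f) (hg : Computes P g) : Computes P (.pair f g) := by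
  simp only [codeRules, List.cons_subset] at hP
  intro n m h
  obtain ⟨a, ha, b, hb, rfl⟩ := mem_eval_pair.1 h
  exact .of_rule _ [n, a, b, Nat.pair a b] hP.1 rfl ⟨hf n a ha, hg n b hb, .pair harith a b⟩

theorem Computes.comp (hP : codeRules (.comp f g) ⊆ P) (hf : Computes P f) (hg : Computes P g) :
    Computes P (.comp f g) := by
  simp only [codeRules, List.cons_subset] at hP
  intro n m h
  obtain ⟨b, hb, hm⟩ := mem_eval_comp.1 h
  exact .of_rule _ [n, b, m] hP.1 rfl ⟨hg n b hb, hf b m hm⟩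

theorem Computes.prec (harith : arithmeticRules ⊆ P) (hP : codeRules (.prec f g) ⊆ P)
    (hf : Computes P f) (hg : Computes P g) : Computes P (.prec f g) := by
  simp only [codeRules, List.cons_subset] at hP
  intro n m h
  obtain ⟨a, k, rfl⟩ : ∃ a k, n = Nat.pair a k := ⟨_, _, (Nat.pair_unpair n).symm⟩
  induction k generalizing m with
  | zero =>
    rw [Code.eval_prec_zero] at h
    exact .of_rule _ [a, Nat.pair a 0, m] hP.1 rfl ⟨.pair harith a 0, hf a m h⟩
  | succ k ih =>
    obtain ⟨v, hv, hm⟩ := mem_eval_prec_succ.1 h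
    exact .of_rule _ [a, k, k + 1, Nat.pair a (k + 1), Nat.pair a k, v, Nat.pair k v,
      Nat.pair a (Nat.pair k v), m] hP.2.1 rfl
      ⟨.pair harith a (k + 1), .succ k (k + 1), .pair harith a k, ih v hv, .pair harith k v,
        .pair harith a (Nat.pair k v), hg _ m hm⟩

theorem Computes.rfind' (harith : arithmeticRules ⊆ P) (hP : codeRules (.rfind' f) ⊆ P)
    (hf : Computes P f) : Computes P (.rfind' f) := by
  simp only [codeRules, List.cons_subset] at hP
  intro n m h
  obtain ⟨a, i, rfl⟩ : ∃ a i, n = Nat.pair a i := ⟨_, _, (Nat.pair_unpair n).symm⟩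
  obtain ⟨k, hk⟩ := evaln_complete.1 h
  clear h
  induction k generalizing i with
  | zero => simp [evaln] at hk
  | succ k ih =>
    obtain ⟨-, v, hv, hm⟩ := mem_evaln_succ_rfind'.1 hk
    have hfv := hf _ v (evaln_sound hv)
    rcases v with _ | v
    · obtain rfl : m = i := hm
      exact .of_rule _ [a, m, Nat.pair a m] hP.1 rfl ⟨.pair harith a m, hfv⟩
    · exact .of_rule _ [a, i, Nat.pair a i, v, v + 1, i + 1, Nat.pair a (i + 1), m] hP.2.1 rfl
        ⟨.pair harith a i, hfv, .succ v (v + 1), .succ i (i + 1), .pair harith a (i + 1), ih _ hm⟩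

theorem computes_of_codeRules_subset (harith : arithmeticRules ⊆ P) (c : Code)
    (hc : codeRules c ⊆ P) : Computes P c := by
  induction c with
  | zero => exact computes_zero hc
  | succ => exact computes_succ hc
  | left => exact computes_left harith hc
  | right => exact computes_right harith hc
  | pair f g hf hg =>
    have h := hc
    simp only [codeRules, List.cons_subset, List.append_subset] at h
    exact .pair harith hc (hf h.2.1) (hg h.2.2)
  | comp f g hf hg =>
    have h := hc
    simp only [codeRules, List.cons_subset, List.append_subset] at h
    exact .comp hc (hf h.2.1) (hg h.2.2)
  | prec f g hf hg =>
    have h := hc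
    simp only [codeRules, List.cons_subset, List.append_subset] at h
    exact .prec harith hc (hf h.2.2.1) (hg h.2.2.2)
  | rfind' f hf =>
    have h := hc
    simp only [codeRules, List.cons_subset] at h
    exact .rfind' harith hc (hf h.2.2)

end Completeness

theorem derivable_program_graph_iff (c : Code) (n m : ℕ) :
    Derivable (program c) (.graph c n m) ↔ m ∈ c.eval n :=
  ⟨fun h => (Atom.isTrue_graph c n m).1 h.isTrue,
    computes_of_codeRules_subset (List.subset_append_left ..) c (List.subset_append_right ..) n m⟩

/-! ### Finite certificates of derivability -/

/-- A derivation step: the derived atom, a rank that is larger than the ranks of the steps it relies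
on, and the values of the variables of the rule applied. -/
structure DerivationStep where
  atom : Atom ℕ
  rank : ℕ
  val : Fin 10 → ℕ
  deriving DecidableEq, Encodable

/-- The step `f` applies the rule `r`, with premises derived by steps in `F` whose ranks are related
to that of `f` by `R`. -/
def DerivationStep.Applies (F : Set DerivationStep) (R : ℕ → ℕ → Prop) (f : DerivationStep)
    (r : Rule) : Prop :=
  f.val 0 = 0 ∧ f.atom = r.head.map f.val ∧
    ∀ a ∈ r.prems, ∃ k ∈ F, k.atom = a.map f.val ∧ R k.rank f.rank

/-- Some step in `F` derives that `y` is the successor of `x`. -/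
def SuccIn (F : Set DerivationStep) (x y : ℕ) : Prop :=
  ∃ f ∈ F, f.atom.tag = 0 ∧ f.atom.x = x ∧ f.atom.y = y

/-- A set `F` of steps and a relation `R` that certify the derivability of an atom with predicate
`g` and first argument `n`. All conditions are first-order and invariant under renaming of values
other than `0, …, n` and the tags, so `R` need not be the order of `ℕ`. -/
structure Certificate (P : List Rule) (g n : ℕ) (F : Set DerivationStep) (R : ℕ → ℕ → Prop) :
    Prop where
  isStrictOrder : IsStrictOrder ℕ R
  rel_of_succIn : ∀ x y, SuccIn F x y → R x y
  not_succIn_zero : ∀ x, ¬ SuccIn F x 0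
  succIn_unique : ∀ x x' y, SuccIn F x y → SuccIn F x' y → x = x'
  justified : ∀ f ∈ F, f.atom.tag = 0 ∨ ∃ r ∈ P, f.Applies F R r
  input : ∀ i < n, SuccIn F i (i + 1)
  goal : ∃ f ∈ F, f.atom.tag = g ∧ f.atom.x = n

theorem wellFounded_of_finite_dom {α : Type*} {R : α → α → Prop} [IsStrictOrder α R]
    (h : {u | ∃ v, R u v}.Finite) : WellFounded R := by
  refine ⟨fun v => (Set.WellFoundedOn.acc_iff_wellFoundedOn.out 0 2).2 ?_⟩
  refine (h.subset fun u hu => ?_).wellFoundedOn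
  obtain ⟨w, huw, -⟩ := Relation.TransGen.head'_iff.1 hu
  exact ⟨w, huw⟩

theorem exists_height_of_wellFounded {α : Type*} {S : α → α → Prop} (hwf : WellFounded S)
    (huniq : ∀ x x' y, S x y → S x' y → x = x') :
    ∃ ι : α → ℕ, (∀ y, (∀ x, ¬ S x y) → ι y = 0) ∧ ∀ x y, S x y → ι y = ι x + 1 := by
  classical
  let ι : α → ℕ := hwf.fix fun y rec =>
    if hy : ∃ x, S x y then rec hy.choose hy.choose_spec + 1 else 0
  have hι : ∀ y, ι y = if hy : ∃ x, S x y then ι hy.choose + 1 else 0 := fun y => hwf.fix_eq _ y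
  refine ⟨ι, fun y hy => ?_, fun x y hxy => ?_⟩
  · rw [hι, dif_neg (not_exists.2 hy)]
  · have hy : ∃ x, S x y := ⟨x, hxy⟩
    rw [hι, dif_pos hy, huniq _ _ _ hxy hy.choose_spec]

section Certificates

variable {P : List Rule} {g n : ℕ}

namespace Certificate

variable {F : Set DerivationStep} {R : ℕ → ℕ → Prop}

theorem exists_interpretation (h : Certificate P g n F R) (hwf : WellFounded R) :
    ∃ ι : ℕ → ℕ, (∀ i ≤ n, ι i = i) ∧ ∀ x y, SuccIn F x y → ι y = ι x + 1 := by
  obtain ⟨ι, hι0, hι⟩ := exists_height_of_wellFounded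
    (Subrelation.wf (h.rel_of_succIn _ _) hwf) h.succIn_unique
  refine ⟨ι, fun i => ?_, hι⟩
  induction i with
  | zero => exact fun _ => hι0 0 h.not_succIn_zero
  | succ i ih =>
    intro hi
    rw [hι i (i + 1) (h.input i hi), ih (Nat.le_of_succ_le hi)]

theorem derivable_map (h : Certificate P g n F R) (hwf : WellFounded R) {ι : ℕ → ℕ} (hι0 : ι 0 = 0)
    (hι : ∀ x y, SuccIn F x y → ι y = ι x + 1) {f : DerivationStep} (hf : f ∈ F) :
    Derivable P (f.atom.map ι) := by
  induction hrank : f.rank using hwf.induction generalizing f with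
  | _ k ih =>
    subst hrank
    rcases h.justified f hf with htag | ⟨r, hr, h0, hatom, hprems⟩
    · have hmap : f.atom.map ι = ⟨0, ι f.atom.x, ι f.atom.x + 1, ι f.atom.z⟩ := by
        rw [Atom.map, htag, hι _ _ ⟨f, hf, htag, rfl, rfl⟩]
      exact hmap ▸ .succ _ _
    · rw [hatom]
      refine .rule r (ι ∘ f.val) hr ((congrArg ι h0).trans hι0) fun a ha => ?_
      obtain ⟨k, hk, hka, hlt⟩ := hprems a ha
      have hder := ih k.rank hlt hk rfl
      rwa [hka] at hder

theorem derivable (h : Certificate P g n F R) (hfin : {u | ∃ v, R u v}.Finite) :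
    ∃ y z, Derivable P ⟨g, n, y, z⟩ := by
  have := h.isStrictOrder
  have hwf : WellFounded R := wellFounded_of_finite_dom hfin
  obtain ⟨ι, hιn, hι⟩ := h.exists_interpretation hwf
  obtain ⟨f, hf, rfl, rfl⟩ := h.goal
  have hder := h.derivable_map hwf (hιn 0 (Nat.zero_le _)) hι hf
  rw [Atom.map, hιn _ le_rfl] at hder
  exact ⟨_, _, hder⟩

end Certificate

theorem DerivationStep.Applies.mono {F F' : Set DerivationStep} {R R' : ℕ → ℕ → Prop}
    {f : DerivationStep} {r : Rule} (h : f.Applies F R r) (hF : F ⊆ F')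
    (hR : ∀ u, R u f.rank → R' u f.rank) : f.Applies F' R' r :=
  ⟨h.1, h.2.1, fun a ha => (h.2.2 a ha).imp fun _ hk => ⟨hF hk.1, hk.2.1, hR _ hk.2.2⟩⟩

/-- Every step in `S` derives a true successor atom or applies a rule to steps of smaller rank. -/
def Justified (P : List Rule) (S : Finset DerivationStep) : Prop :=
  ∀ f ∈ S, (∃ x z, f.atom = ⟨0, x, x + 1, z⟩) ∨ ∃ r ∈ P, f.Applies S (· < ·) r

namespace Justified

variable {S T : Finset DerivationStep}

theorem union (hS : Justified P S) (hT : Justified P T) : Justified P (S ∪ T) := by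
  intro f hf
  rcases Finset.mem_union.1 hf with hf | hf
  · exact (hS f hf).imp_right fun ⟨r, hr, h⟩ =>
      ⟨r, hr, h.mono (mod_cast Finset.subset_union_left) fun _ => id⟩
  · exact (hT f hf).imp_right fun ⟨r, hr, h⟩ =>
      ⟨r, hr, h.mono (mod_cast Finset.subset_union_right) fun _ => id⟩

theorem insert (hS : Justified P S) {f : DerivationStep} {r : Rule} (hr : r ∈ P)
    (hf : f.Applies S (· < ·) r) : Justified P (insert f S) := by
  intro k hk
  have hsub : (S : Set DerivationStep) ⊆ ↑(Insert.insert f S) := mod_cast Finset.subset_insert f S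
  rcases Finset.mem_insert.1 hk with rfl | hk
  · exact .inr ⟨r, hr, hf.mono hsub fun _ => id⟩
  · exact (hS k hk).imp_right fun ⟨q, hq, h⟩ => ⟨q, hq, h.mono hsub fun _ => id⟩

theorem eq_succ_of_succIn (hS : Justified P S) {x y : ℕ} (h : SuccIn S x y) : y = x + 1 := by
  obtain ⟨f, hf, htag, rfl, rfl⟩ := h
  rcases hS f hf with ⟨x, z, hatom⟩ | ⟨r, -, -, hatom, -⟩
  · rw [hatom]
  · exact absurd (congrArg Atom.tag hatom ▸ htag) r.head_tag_ne

theorem exists_forall_mem {l : List (Atom ℕ)}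
    (h : ∀ a ∈ l, ∃ S, Justified P S ∧ ∃ f ∈ S, f.atom = a) :
    ∃ S, Justified P S ∧ ∀ a ∈ l, ∃ f ∈ S, f.atom = a := by
  induction l with
  | nil => exact ⟨∅, by simp [Justified]⟩
  | cons a l ih =>
    rw [List.forall_mem_cons] at h
    obtain ⟨⟨S, hS, f, hf, hfa⟩, hl⟩ := h
    obtain ⟨T, hT, hTl⟩ := ih hl
    refine ⟨S ∪ T, hS.union hT, List.forall_mem_cons.2 ⟨⟨f, Finset.mem_union_left T hf, hfa⟩, ?_⟩⟩
    exact fun b hb => (hTl b hb).imp fun k hk => ⟨Finset.mem_union_right S hk.1, hk.2⟩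

end Justified

theorem Derivable.exists_justified {a : Atom ℕ} (h : Derivable P a) :
    ∃ S, Justified P S ∧ ∃ f ∈ S, f.atom = a := by
  induction h with
  | succ x z =>
    refine ⟨{⟨⟨0, x, x + 1, z⟩, 0, 0⟩}, fun f hf => ?_, _, Finset.mem_singleton_self _, rfl⟩
    exact .inl ⟨x, z, congrArg _ (Finset.mem_singleton.1 hf)⟩
  | rule r σ hr h0 _ ih =>
    obtain ⟨S, hS, hprems⟩ := Justified.exists_forall_mem (List.forall_mem_map.2 ih)
    let f : DerivationStep := ⟨r.head.map σ, S.sup DerivationStep.rank + 1, σ⟩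
    refine ⟨insert f S, hS.insert hr ⟨h0, rfl, fun a ha => ?_⟩, f, Finset.mem_insert_self f S, rfl⟩
    obtain ⟨k, hk, hka⟩ := hprems _ (List.mem_map_of_mem ha)
    exact ⟨k, hk, hka, Nat.lt_succ_of_le (Finset.le_sup hk)⟩

/-- The order of the numbers below `N`. -/
def LtBelow (N u v : ℕ) : Prop := u < v ∧ v < N

instance (N : ℕ) : IsStrictOrder ℕ (LtBelow N) where
  irrefl _ h := h.1.false
  trans _ _ _ h₁ h₂ := ⟨h₁.1.trans h₂.1, h₂.2⟩

theorem Justified.exists_certificate {S : Finset DerivationStep} (hS : Justified P S)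
    (hinput : ∀ i < n, SuccIn S i (i + 1)) (hgoal : ∃ f ∈ S, f.atom.tag = g ∧ f.atom.x = n) :
    ∃ N, Certificate P g n S (LtBelow N) := by
  let N := S.sup fun f => max f.atom.y f.rank
  have hN : ∀ f ∈ S, f.atom.y < N + 1 ∧ f.rank < N + 1 := fun f hf => by
    have hle : max f.atom.y f.rank ≤ N := Finset.le_sup (f := fun f => max f.atom.y f.rank) hf
    omega
  refine ⟨N + 1, inferInstance, fun x y h => ?_, fun x h => ?_, fun x x' y h h' => ?_,
    fun f hf => ?_, hinput, hgoal⟩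
  · obtain rfl := hS.eq_succ_of_succIn h
    obtain ⟨f, hf, -, -, hy⟩ := h
    exact ⟨x.lt_succ_self, hy ▸ (hN f hf).1⟩
  · exact absurd (hS.eq_succ_of_succIn h) (Nat.succ_ne_zero x).symm
  · exact Nat.succ_injective ((hS.eq_succ_of_succIn h).symm.trans (hS.eq_succ_of_succIn h'))
  · refine (hS f hf).imp (fun ⟨x, z, h⟩ => h ▸ rfl) fun ⟨r, hr, h⟩ => ⟨r, hr, ?_⟩
    exact h.mono subset_rfl fun u hu => ⟨hu, (hN f hf).2⟩

theorem Derivable.exists_certificate {y z : ℕ} (h : Derivable P ⟨g, n, y, z⟩) :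
    ∃ (S : Finset DerivationStep) (N : ℕ), Certificate P g n S (LtBelow N) := by
  let inputs : List (Atom ℕ) := (List.range n).map fun i => .succ i (i + 1)
  have hder : ∀ a ∈ ⟨g, n, y, z⟩ :: inputs, Derivable P a :=
    List.forall_mem_cons.2 ⟨h, List.forall_mem_map.2 fun i _ => .succ i (i + 1)⟩
  obtain ⟨S, hS, hmem⟩ :=
    Justified.exists_forall_mem fun a ha => (hder a ha).exists_justified
  refine ⟨S, hS.exists_certificate (fun i hi => ?_) ?_⟩
  · obtain ⟨f, hf, hfa⟩ := hmem (.succ i (i + 1))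
      (List.mem_cons_of_mem _ (List.mem_map_of_mem (List.mem_range.2 hi)))
    exact ⟨f, hf, by simp [hfa, Atom.succ]⟩
  · obtain ⟨f, hf, hfa⟩ := hmem _ List.mem_cons_self
    exact ⟨f, hf, by simp [hfa]⟩

end Certificates

/-! ### The model of a Horn program -/

/-- `C.allInstances()`. -/
def allOf (c : ℕ) : Path := ⟨.allInstances c false, []⟩

/-- The attribute `a` of the variable `x`. -/
def attrOf (x a : ℕ) : ValExpr := .attr ⟨.var x, []⟩ a false

namespace OCL

/-- Equality of the value sets of `s` and `t`; OCL only has the inclusions. -/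
def valEq (s t : ValExpr) : OCL := .and (.valIncludesAll s t) (.valIncludesAll t s)

/-- The implication `φ → ψ`. -/
def imp (φ ψ : OCL) : OCL := .or (.not φ) ψ

/-- The conjunction of the constraints in `l`. -/
def conj (l : List OCL) : OCL := l.foldr .and .tt

/-- The disjunction of the constraints in `l`. -/
def disj (l : List OCL) : OCL := l.foldr .or (.not .tt)

end OCL

/-- Class `0` is the artifact, with the states `1` (running) and `2` (terminated). The objects of
class `3` are derivation steps: attribute `2` is the predicate of the derived atom, attributes `3`,
`4`, `5` are its arguments, attribute `6` is the rank and attribute `7 + i` the value of variable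
`i`. The objects of class `4` are pairs of related values, in the attributes `0` and `1`. -/
def certDiagram : ClassDiagram where
  numClasses := 5
  isa := [(1, 0), (2, 0)]
  assocs := []
  attrs := List.replicate 2 ⟨4, true⟩ ++ List.replicate 15 ⟨3, true⟩
  roClasses := []
  roAssocs := []

/-- Some pair consists of the values of `s` and `t`. Variable `3` must not occur in `s` and `t`. -/
def precedesOCL (s t : ValExpr) : OCL :=
  .exists_ (allOf 4) 3 (.and (.valEq (attrOf 3 0) s) (.valEq (attrOf 3 1) t))

/-- The pairs form a transitive relation. -/
def transOCL : OCL :=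
  .forAll (allOf 4) 1 (.forAll (allOf 4) 2 (.imp (.valEq (attrOf 1 1) (attrOf 2 0))
    (precedesOCL (attrOf 1 0) (attrOf 2 1))))

/-- The pairs form an irreflexive relation. -/
def irreflOCL : OCL := .forAll (allOf 4) 1 (.not (.valEq (attrOf 1 0) (attrOf 1 1)))

/-- `φ` holds for all steps `x` that derive a successor atom. -/
def forAllSucc (x : ℕ) (φ : OCL) : OCL :=
  .forAll (allOf 3) x (.imp (.valEq (attrOf x 2) (.const 0)) φ)

/-- The successor steps derive only pairs. -/
def precedesSuccOCL : OCL := forAllSucc 1 (precedesOCL (attrOf 1 3) (attrOf 1 4))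

/-- Zero is not a successor. -/
def succNeZeroOCL : OCL := forAllSucc 1 (.not (.valEq (attrOf 1 4) (.const 0)))

/-- The successor relation is injective. -/
def succInjOCL : OCL :=
  forAllSucc 1 (forAllSucc 2 (.imp (.valEq (attrOf 1 4) (attrOf 2 4))
    (.valEq (attrOf 1 3) (attrOf 2 3))))

/-- The step in variable `x` derives the instance of `a` at the values in the step in variable
`1`. -/
def atomOCL (x : ℕ) (a : Atom (Fin 10)) : OCL :=
  .and (.valEq (attrOf x 2) (.const a.tag))
    (.and (.valEq (attrOf x 3) (attrOf 1 (7 + a.x)))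
      (.and (.valEq (attrOf x 4) (attrOf 1 (7 + a.y)))
        (.valEq (attrOf x 5) (attrOf 1 (7 + a.z)))))

/-- The premise `a` of the step in variable `1` is derived by a preceding step. -/
def premOCL (a : Atom (Fin 10)) : OCL :=
  .exists_ (allOf 3) 2 (.and (atomOCL 2 a) (precedesOCL (attrOf 2 6) (attrOf 1 6)))

/-- The step in variable `1` applies the rule `r`. -/
def ruleOCL (r : Rule) : OCL :=
  .and (.valEq (attrOf 1 7) (.const 0))
    (.and (atomOCL 1 r.head) (.conj (r.prems.map premOCL)))

/-- Every step is a successor step or applies a rule of `P`. -/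
def justifiedOCL (P : List Rule) : OCL :=
  .forAll (allOf 3) 1 (.or (.valEq (attrOf 1 2) (.const 0)) (.disj (P.map ruleOCL)))

/-- Some step derives that `i + 1` is the successor of `i`. -/
def inputOCL (i : ℕ) : OCL :=
  .exists_ (allOf 3) 1 (.and (.valEq (attrOf 1 2) (.const 0))
    (.and (.valEq (attrOf 1 3) (.const i)) (.valEq (attrOf 1 4) (.const (i + 1)))))

/-- Some step derives an atom with predicate `g` and first argument `n`. -/
def goalOCL (g n : ℕ) : OCL :=
  .exists_ (allOf 3) 1 (.and (.valEq (attrOf 1 2) (.const g)) (.valEq (attrOf 1 3) (.const n)))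

/-- The constraints by which the steps and the pairs form a `Certificate`. -/
def certOCL (P : List Rule) (g n : ℕ) : List OCL :=
  [transOCL, irreflOCL, precedesSuccOCL, succNeZeroOCL, succInjOCL, justifiedOCL P, goalOCL g n] ++
    (List.range n).map inputOCL

/-- The constraint `φ`, imposed as soon as some artifact instance is terminated. -/
def onTermination (φ : OCL) : OCL := .or (.isEmpty (allOf 2)) φ

/-- The task that creates an artifact instance. -/
def createTask : Task := ⟨true, .tt, .oclIsTypeOf 0 1⟩

/-- The task that terminates its artifact instance. Nothing restricts what it does to the steps and
the pairs. -/
def completeTask : Task := ⟨false, .tt, .oclIsTypeOf 0 2⟩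

/-- The activity of the initial transition. -/
def createActivity : Activity where
  nodes := [.initial, .action createTask, .final]
  edges := [⟨0, 1, .tt⟩, ⟨1, 2, .tt⟩]

/-- The activity of the completion transition. Its task can be repeated, so that a running
completion activity can always move its instance to the termination state, whatever other tasks have
done in the meantime. -/
def completeActivity : Activity where
  nodes := [.initial, .merge, .action completeTask, .final]
  edges := [⟨0, 1, .tt⟩, ⟨1, 2, .tt⟩, ⟨2, 1, .tt⟩, ⟨2, 3, .tt⟩]

/-- The artifact of `certModel`: instances are created running, and complete on event `1`. -/
def certArtifact : Artifact where
  cls := 0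
  initial := 1
  final := 2
  transitions := [⟨none, 0, .tt, 1⟩, ⟨some 1, 1, .tt, 2⟩]
  activities := [createActivity, completeActivity]

/-- Artifact instances are created in the running state, and can be terminated only in the presence
of a certificate. -/
def certModel (P : List Rule) (g n : ℕ) : Model where
  diagram := certDiagram
  constraints := (certOCL P g n).map onTermination
  artifacts := [certArtifact]

/-! ### Well-formedness -/

section Ok

variable {M : ClassDiagram} {op post : Bool} {sc : List ℕ}

theorem ok_allOf {c : ℕ} : (allOf c).Ok M post sc ↔ c < M.numClasses := by
  simp [allOf, Path.Ok, Source.Ok]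

theorem ok_attrOf {x a : ℕ} : (attrOf x a).Ok M op post sc ↔ x ∈ sc ∧ a < M.attrs.length := by
  simp [attrOf, ValExpr.Ok, Path.Ok, Source.Ok]

theorem ok_const {v : ℕ} : (ValExpr.const v).Ok M op post sc ↔ True := Iff.rfl

namespace OCL

theorem ok_valEq {s t : ValExpr} :
    (valEq s t).Ok M op post sc ↔ s.Ok M op post sc ∧ t.Ok M op post sc :=
  ⟨And.left, fun h => ⟨h, h.symm⟩⟩

theorem ok_conj {l : List OCL} (h : ∀ φ ∈ l, φ.Ok M op post sc) : (conj l).Ok M op post sc := by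
  induction l with
  | nil => trivial
  | cons φ l ih =>
    rw [List.forall_mem_cons] at h
    exact ⟨h.1, ih h.2⟩

theorem ok_disj {l : List OCL} (h : ∀ φ ∈ l, φ.Ok M op post sc) : (disj l).Ok M op post sc := by
  induction l with
  | nil => trivial
  | cons φ l ih =>
    rw [List.forall_mem_cons] at h
    exact ⟨h.1, ih h.2⟩

end OCL

theorem certDiagram_numClasses : certDiagram.numClasses = 5 := rfl

theorem length_certDiagram_attrs : certDiagram.attrs.length = 17 := rfl

theorem precedesOCL_ok {s t : ValExpr} (hs : s.Ok certDiagram op post (3 :: sc))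
    (ht : t.Ok certDiagram op post (3 :: sc)) : (precedesOCL s t).Ok certDiagram op post sc := by
  simp [precedesOCL, OCL.Ok, OCL.ok_valEq, ok_allOf, ok_attrOf, certDiagram_numClasses,
    length_certDiagram_attrs, hs, ht]

theorem atomOCL_ok {x : ℕ} {a : Atom (Fin 10)} (hx : x ∈ sc) (h1 : 1 ∈ sc) :
    (atomOCL x a).Ok certDiagram op post sc := by
  simp only [atomOCL, OCL.Ok, OCL.ok_valEq, ok_const, ok_attrOf, length_certDiagram_attrs, hx, h1,
    true_and, and_true]
  omega

theorem ruleOCL_ok (r : Rule) (h1 : 1 ∈ sc) : (ruleOCL r).Ok certDiagram op post sc := by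
  refine ⟨?_, atomOCL_ok h1 h1, OCL.ok_conj (List.forall_mem_map.2 fun a _ => ⟨?_, ?_, ?_⟩)⟩
  · simp [OCL.ok_valEq, ok_const, ok_attrOf, length_certDiagram_attrs, h1]
  · simp [ok_allOf, certDiagram_numClasses]
  · exact atomOCL_ok List.mem_cons_self (List.mem_cons_of_mem _ h1)
  · exact precedesOCL_ok (by simp [ok_attrOf, length_certDiagram_attrs])
      (by simp [ok_attrOf, length_certDiagram_attrs, h1])

theorem justifiedOCL_ok (P : List Rule) : (justifiedOCL P).Ok certDiagram op post sc := by
  refine ⟨?_, ?_, OCL.ok_disj (List.forall_mem_map.2 fun r _ => ruleOCL_ok r (by simp))⟩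
  · simp [ok_allOf, certDiagram_numClasses]
  · simp [OCL.ok_valEq, ok_const, ok_attrOf, length_certDiagram_attrs]

theorem certOCL_ok (P : List Rule) (g n : ℕ) :
    ∀ φ ∈ certOCL P g n, φ.Ok certDiagram op post sc := by
  simp [certOCL, transOCL, irreflOCL, forAllSucc, precedesSuccOCL, succNeZeroOCL, succInjOCL,
    goalOCL, inputOCL, OCL.imp, OCL.Ok, OCL.ok_valEq, ok_const, ok_allOf, ok_attrOf,
    precedesOCL_ok, justifiedOCL_ok, certDiagram_numClasses, length_certDiagram_attrs]

end Ok

theorem createActivity_wellFormed : createActivity.WellFormed certDiagram where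
  edge_ends := by simp [createActivity]
  initial_unique := ⟨0, rfl, fun n hn => by
    rcases n with _ | _ | _ | n <;> simp_all [createActivity]⟩
  degrees := by
    rintro (_ | _ | _ | n) k h <;> simp only [createActivity] at h <;> cases h <;>
      simp only [Node.DegreesOk] <;> decide
  guards := by simp [createActivity]
  guard_ok := by simp [createActivity, OCL.Ok]
  task_ok := by simp [Activity.HasTask, createActivity, createTask, OCL.Ok, certDiagram]

theorem completeActivity_wellFormed : completeActivity.WellFormed certDiagram where
  edge_ends := by simp [completeActivity]
  initial_unique := ⟨0, rfl, fun n hn => by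
    rcases n with _ | _ | _ | _ | n <;> simp_all [completeActivity]⟩
  degrees := by
    rintro (_ | _ | _ | _ | n) k h <;> simp only [completeActivity] at h <;> cases h <;>
      simp only [Node.DegreesOk] <;> decide
  guards := by simp [completeActivity]
  guard_ok := by simp [completeActivity, OCL.Ok]
  task_ok := by simp [Activity.HasTask, completeActivity, completeTask, OCL.Ok, certDiagram]

theorem certDiagram_sub {c d : ℕ} :
    certDiagram.Sub c d ↔ c = d ∨ (d = 0 ∧ (c = 1 ∨ c = 2)) := by
  constructor
  · intro h
    induction h with
    | refl => exact Or.inl rfl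
    | tail _ h ih =>
      simp only [certDiagram, List.mem_cons, Prod.mk.injEq, List.not_mem_nil, or_false] at h
      omega
  · rintro (rfl | ⟨rfl, rfl | rfl⟩)
    · exact .refl
    · exact .single (by simp [certDiagram])
    · exact .single (by simp [certDiagram])

theorem certArtifact_isState {c : ℕ} :
    certArtifact.IsState certDiagram c ↔ c = 1 ∨ c = 2 := by
  simp only [Artifact.IsState, certDiagram_sub, ClassDiagram.IsLeaf]
  simp only [certArtifact, certDiagram, List.mem_cons, Prod.mk.injEq, List.not_mem_nil, or_false]
  grind

theorem certArtifact_wellFormed : certArtifact.WellFormed certDiagram where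
  cls_valid := by simp [certArtifact, certDiagram]
  cls_top := by simp [certArtifact, certDiagram]
  cls_rw := by simp [certDiagram]
  initial_state := certArtifact_isState.2 (Or.inl rfl)
  final_state := certArtifact_isState.2 (Or.inr rfl)
  trans_states := by simp only [certArtifact_isState]; simp [certArtifact]
  trans_event := by simp [certArtifact]
  trans_cond := by simp [certArtifact, OCL.Ok]
  trans_creates := by
    simp [certArtifact, Activity.HasTask, completeActivity, completeTask]
  activity_ok := by
    simp [certArtifact, createActivity_wellFormed, completeActivity_wellFormed]

theorem certModel_wellFormed (P : List Rule) (g n : ℕ) : (certModel P g n).WellFormed where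
  isa_valid := by simp [certModel, certDiagram]
  isa_acyclic := by
    have hlt : ∀ c d, Relation.TransGen (fun c d => (c, d) ∈ certDiagram.isa) c d → d < c := by
      intro c d h
      induction h with
      | single h =>
        simp only [certDiagram, List.mem_cons, Prod.mk.injEq, List.not_mem_nil, or_false] at h
        omega
      | tail _ h ih =>
        simp only [certDiagram, List.mem_cons, Prod.mk.injEq, List.not_mem_nil, or_false] at h
        omega
    exact fun c hc => lt_irrefl _ (hlt c c hc)
  assoc_valid := by simp [certModel, certDiagram]
  attr_valid := by
    simp only [certModel, certDiagram, List.mem_append, List.mem_replicate]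
    rintro a (⟨-, rfl⟩ | ⟨-, rfl⟩) <;> simp
  constraint_ok :=
    List.forall_mem_map.2 fun φ hφ => ⟨by simp [OCL.Ok, ok_allOf, certModel, certDiagram],
      certOCL_ok P g n φ hφ⟩
  artifact_ok := by simpa [certModel] using certArtifact_wellFormed
  artifact_disjoint := by
    have heq : ∀ i A, (certModel P g n).artifacts[i]? = some A → i = 0 := fun i A h => by
      simpa [certModel] using (List.getElem?_eq_some_iff.1 h).1
    intro i j A A' hi hj _ _ _
    rw [heq i A hi, heq j A' hj]

theorem certModel_unidirectional (P : List Rule) (g n : ℕ) :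
    (certModel P g n).Unidirectional := by
  refine ⟨⟨?_, ?_⟩, fun c _ _ d _ h => ?_⟩
  · simp [Model.HasTask, Activity.HasTask, certModel, certArtifact, createActivity,
      completeActivity, createTask, completeTask, OCL.Navigational]
  · simp [Model.HasCond, certModel, certArtifact, createActivity, completeActivity,
      OCL.Navigational]
  · obtain ⟨_, h, -⟩ := Relation.TransGen.head'_iff.1 h
    simp [Model.DependsStep, certModel, certDiagram] at h

/-! ### Semantics of the constraints -/

section Connectives

variable {M : ClassDiagram} {I₀ I : InfoBase} {π ρ : ℕ → Option ℕ} {φ ψ : OCL}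

namespace OCL

theorem holds_and : (and φ ψ).Holds M I₀ I π ρ ↔ φ.Holds M I₀ I π ρ ∧ ψ.Holds M I₀ I π ρ := Iff.rfl

theorem holds_or : (or φ ψ).Holds M I₀ I π ρ ↔ φ.Holds M I₀ I π ρ ∨ ψ.Holds M I₀ I π ρ := Iff.rfl

theorem holds_imp :
    (imp φ ψ).Holds M I₀ I π ρ ↔ (φ.Holds M I₀ I π ρ → ψ.Holds M I₀ I π ρ) :=
  imp_iff_not_or.symm

theorem holds_conj {l : List OCL} :
    (conj l).Holds M I₀ I π ρ ↔ ∀ φ ∈ l, φ.Holds M I₀ I π ρ := by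
  induction l with
  | nil => exact iff_of_true trivial (List.forall_mem_nil _)
  | cons φ l ih =>
    rw [List.forall_mem_cons, ← ih]
    rfl

theorem holds_disj {l : List OCL} :
    (disj l).Holds M I₀ I π ρ ↔ ∃ φ ∈ l, φ.Holds M I₀ I π ρ := by
  induction l with
  | nil => exact iff_of_false (not_not_intro trivial) (by simp)
  | cons φ l ih =>
    rw [List.exists_mem_cons_iff, ← ih]
    rfl

theorem holds_valEq {s t : ValExpr} :
    (valEq s t).Holds M I₀ I π ρ ↔ s.eval M I₀ I π ρ = t.eval M I₀ I π ρ :=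
  Set.Subset.antisymm_iff.symm.trans eq_comm

theorem holds_forAll_allOf {c x : ℕ} :
    (forAll (allOf c) x φ).Holds M I₀ I π ρ ↔
      ∀ o, M.HasType I o c → φ.Holds M I₀ I π (Function.update ρ x (some o)) := Iff.rfl

theorem holds_exists_allOf {c x : ℕ} :
    (exists_ (allOf c) x φ).Holds M I₀ I π ρ ↔
      ∃ o, M.HasType I o c ∧ φ.Holds M I₀ I π (Function.update ρ x (some o)) := Iff.rfl

theorem holds_isEmpty_allOf {c : ℕ} :
    (isEmpty (allOf c)).Holds M I₀ I π ρ ↔ ∀ o, ¬ M.HasType I o c :=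
  Set.eq_empty_iff_forall_notMem

end OCL

end Connectives

/-- The value of the attribute `a` of the object `o`, and `0` if there is none. -/
noncomputable def attrValue (I : InfoBase) (a o : ℕ) : ℕ := sInf {v | Fact.val a o v ∈ I}

theorem attrValue_eq {M : ClassDiagram} {I : InfoBase} (hI : M.IsInstance I) {a o v : ℕ}
    (h : Fact.val a o v ∈ I) : attrValue I a o = v := by
  have hset : {w | Fact.val a o w ∈ I} = {v} :=
    Set.eq_singleton_iff_unique_mem.2 ⟨h, fun w hw => hI.val_unique a o w v hw h⟩
  rw [attrValue, hset, csInf_singleton]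

theorem eval_attrOf {M : ClassDiagram} {I : InfoBase} (hI : M.IsInstance I)
    {π ρ : ℕ → Option ℕ} {x a o : ℕ} {d : Attr} (hd : M.attrs[a]? = some d)
    (hreq : d.required = true) (ho : M.HasType I o d.owner) (hx : ρ x = some o) :
    (attrOf x a).eval M I I π ρ = {attrValue I a o} := by
  obtain ⟨v, hv⟩ := hI.val_required a d o hd hreq ho
  rw [attrValue_eq hI hv]
  ext w
  simp only [attrOf, ValExpr.eval, Path.eval, Source.eval, List.foldl_nil, Set.mem_ofPred_eq, hx,
    Option.some.injEq, ite_self, exists_eq_left', Set.mem_singleton_iff]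
  exact ⟨fun hw => hI.val_unique a o w v hw hv, fun hw => hw ▸ hv⟩

/-- The derivation step stored in the object `o` of class `3`. -/
noncomputable def stepOf (I : InfoBase) (o : ℕ) : DerivationStep where
  atom := ⟨attrValue I 2 o, attrValue I 3 o, attrValue I 4 o, attrValue I 5 o⟩
  rank := attrValue I 6 o
  val i := attrValue I (7 + i) o

/-- The derivation steps stored in the objects of class `3`. -/
def steps (I : InfoBase) : Set DerivationStep := stepOf I '' {o | Fact.inst o 3 ∈ I}

/-- The relation stored in the objects of class `4`. -/
def Precedes (I : InfoBase) (u v : ℕ) : Prop :=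
  ∃ l, Fact.inst l 4 ∈ I ∧ attrValue I 0 l = u ∧ attrValue I 1 l = v

theorem exists_mem_steps {I : InfoBase} {p : DerivationStep → Prop} :
    (∃ f ∈ steps I, p f) ↔ ∃ o, Fact.inst o 3 ∈ I ∧ p (stepOf I o) :=
  Set.exists_mem_image

theorem forall_mem_steps {I : InfoBase} {p : DerivationStep → Prop} :
    (∀ f ∈ steps I, p f) ↔ ∀ o, Fact.inst o 3 ∈ I → p (stepOf I o) :=
  Set.forall_mem_image

theorem certDiagram_hasType {I : InfoBase} {o c : ℕ} (hc : c ≠ 0) :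
    certDiagram.HasType I o c ↔ Fact.inst o c ∈ I := by
  simp [ClassDiagram.HasType, certDiagram_sub, hc]

theorem certDiagram_getElem?_attrs {a : ℕ} (ha : a < 17) :
    certDiagram.attrs[a]? = some ⟨if a < 2 then 4 else 3, true⟩ := by
  interval_cases a <;> rfl

section Holds

variable {I : InfoBase} {π ρ : ℕ → Option ℕ} {x y o k : ℕ}

theorem eval_attrOf_step (hI : certDiagram.IsInstance I) (ho : Fact.inst o 3 ∈ I)
    (hx : ρ x = some o := by rfl) {a : ℕ} (h2 : 2 ≤ a := by decide) (h17 : a < 17 := by decide) :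
    (attrOf x a).eval certDiagram I I π ρ = {attrValue I a o} := by
  refine eval_attrOf hI (certDiagram_getElem?_attrs h17) rfl ?_ hx
  rwa [if_neg h2.not_gt, certDiagram_hasType (by simp)]

theorem eval_attrOf_pair (hI : certDiagram.IsInstance I) (ho : Fact.inst o 4 ∈ I)
    (hx : ρ x = some o := by rfl) {a : ℕ} (h2 : a < 2 := by decide) :
    (attrOf x a).eval certDiagram I I π ρ = {attrValue I a o} := by
  refine eval_attrOf hI (certDiagram_getElem?_attrs (h2.trans (by simp))) rfl ?_ hx
  rwa [if_pos h2, certDiagram_hasType (by simp)]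

theorem holds_valEq_of_eval {M : ClassDiagram} {I₀ : InfoBase} {s t : ValExpr} {u v : ℕ}
    (hs : s.eval M I₀ I π ρ = {u}) (ht : t.eval M I₀ I π ρ = {v}) :
    (OCL.valEq s t).Holds M I₀ I π ρ ↔ u = v := by
  rw [OCL.holds_valEq, hs, ht, Set.singleton_eq_singleton_iff]

theorem holds_precedesOCL (hI : certDiagram.IsInstance I) {s t : ValExpr} {u v : ℕ}
    (hs : ∀ l, s.eval certDiagram I I π (Function.update ρ 3 (some l)) = {u})
    (ht : ∀ l, t.eval certDiagram I I π (Function.update ρ 3 (some l)) = {v}) :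
    (precedesOCL s t).Holds certDiagram I I π ρ ↔ Precedes I u v := by
  rw [precedesOCL, OCL.holds_exists_allOf]
  refine exists_congr fun l => ?_
  rw [certDiagram_hasType (by simp)]
  refine and_congr_right fun hl => ?_
  have hl3 : Function.update ρ 3 (some l) 3 = some l := rfl
  rw [OCL.holds_and, holds_valEq_of_eval (eval_attrOf_pair hI hl hl3) (hs l),
    holds_valEq_of_eval (eval_attrOf_pair hI hl hl3) (ht l)]

theorem holds_forAllSucc (hI : certDiagram.IsInstance I) {φ : OCL} :
    (forAllSucc x φ).Holds certDiagram I I π ρ ↔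
      ∀ o, Fact.inst o 3 ∈ I → (stepOf I o).atom.tag = 0 →
        φ.Holds certDiagram I I π (Function.update ρ x (some o)) := by
  rw [forAllSucc, OCL.holds_forAll_allOf]
  refine forall_congr' fun o => ?_
  rw [certDiagram_hasType (by simp)]
  refine imp_congr_right fun ho => ?_
  have hx : Function.update ρ x (some o) x = some o := Function.update_self ..
  rw [OCL.holds_imp, holds_valEq_of_eval (eval_attrOf_step hI ho hx (by simp) (by simp)) rfl]
  rfl

theorem holds_atomOCL (hI : certDiagram.IsInstance I) (hk : Fact.inst k 3 ∈ I)
    (ho : Fact.inst o 3 ∈ I) (hx : ρ x = some k) (h1 : ρ 1 = some o) {a : Atom (Fin 10)} :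
    (atomOCL x a).Holds certDiagram I I π ρ ↔ (stepOf I k).atom = a.map (stepOf I o).val := by
  have hval (i : Fin 10) : (attrOf 1 (7 + i)).eval certDiagram I I π ρ = {attrValue I (7 + i) o} :=
    eval_attrOf_step hI ho h1 (by omega) (by omega)
  rw [atomOCL, OCL.holds_and, OCL.holds_and, OCL.holds_and,
    holds_valEq_of_eval (eval_attrOf_step hI hk hx) rfl,
    holds_valEq_of_eval (eval_attrOf_step hI hk hx) (hval _),
    holds_valEq_of_eval (eval_attrOf_step hI hk hx) (hval _),
    holds_valEq_of_eval (eval_attrOf_step hI hk hx) (hval _)]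
  simp only [stepOf, Atom.map, Atom.mk.injEq]

theorem holds_premOCL (hI : certDiagram.IsInstance I) (ho : Fact.inst o 3 ∈ I)
    (h1 : ρ 1 = some o) {a : Atom (Fin 10)} :
    (premOCL a).Holds certDiagram I I π ρ ↔
      ∃ k ∈ steps I, k.atom = a.map (stepOf I o).val ∧ Precedes I k.rank (stepOf I o).rank := by
  rw [premOCL, OCL.holds_exists_allOf, exists_mem_steps]
  refine exists_congr fun k => ?_
  rw [certDiagram_hasType (by simp)]
  refine and_congr_right fun hk => ?_
  have hk2 : Function.update ρ 2 (some k) 2 = some k := rfl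
  have ho1 : Function.update ρ 2 (some k) 1 = some o := h1
  rw [OCL.holds_and]
  exact and_congr (holds_atomOCL hI hk ho hk2 ho1)
    (holds_precedesOCL hI (fun _ => eval_attrOf_step hI hk)
      fun _ => eval_attrOf_step hI ho (by exact h1))

theorem holds_ruleOCL (hI : certDiagram.IsInstance I) (ho : Fact.inst o 3 ∈ I)
    (h1 : ρ 1 = some o) {r : Rule} :
    (ruleOCL r).Holds certDiagram I I π ρ ↔
      (stepOf I o).Applies (steps I) (Precedes I) r := by
  rw [ruleOCL, OCL.holds_and, OCL.holds_and, holds_atomOCL hI ho ho h1 h1,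
    holds_valEq_of_eval (eval_attrOf_step hI ho h1) rfl, OCL.holds_conj, List.forall_mem_map]
  exact and_congr_right fun _ => and_congr_right fun _ =>
    forall₂_congr fun a _ => holds_premOCL hI ho h1

theorem holds_transOCL (hI : certDiagram.IsInstance I) :
    transOCL.Holds certDiagram I I π ρ ↔ IsTrans ℕ (Precedes I) := by
  have hholds : transOCL.Holds certDiagram I I π ρ ↔
      ∀ l, Fact.inst l 4 ∈ I → ∀ m, Fact.inst m 4 ∈ I → attrValue I 1 l = attrValue I 0 m →
        Precedes I (attrValue I 0 l) (attrValue I 1 m) := by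
    simp only [transOCL, OCL.holds_forAll_allOf, certDiagram_hasType (four_ne_zero (α := ℕ))]
    refine forall₂_congr fun l hl => forall₂_congr fun m hm => ?_
    rw [OCL.holds_imp]
    exact imp_congr (holds_valEq_of_eval (eval_attrOf_pair hI hl) (eval_attrOf_pair hI hm))
      (holds_precedesOCL hI (fun _ => eval_attrOf_pair hI hl) fun _ => eval_attrOf_pair hI hm)
  rw [hholds]
  constructor
  · refine fun h => ⟨?_⟩
    rintro _ _ _ ⟨l, hl, rfl, rfl⟩ ⟨m, hm, hlm, rfl⟩
    exact h l hl m hm hlm.symm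
  · exact fun h l hl m hm hlm => h.trans _ _ _ ⟨l, hl, rfl, rfl⟩ ⟨m, hm, hlm.symm, rfl⟩

theorem holds_irreflOCL (hI : certDiagram.IsInstance I) :
    irreflOCL.Holds certDiagram I I π ρ ↔ Std.Irrefl (Precedes I) := by
  have hholds : irreflOCL.Holds certDiagram I I π ρ ↔
      ∀ l, Fact.inst l 4 ∈ I → attrValue I 0 l ≠ attrValue I 1 l := by
    simp only [irreflOCL, OCL.holds_forAll_allOf, certDiagram_hasType (four_ne_zero (α := ℕ))]
    exact forall₂_congr fun l hl => not_congr <|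
      holds_valEq_of_eval (eval_attrOf_pair hI hl) (eval_attrOf_pair hI hl)
  rw [hholds]
  constructor
  · refine fun h => ⟨?_⟩
    rintro _ ⟨l, hl, h0, h1⟩
    exact h l hl (h0.trans h1.symm)
  · exact fun h l hl hne => h.irrefl _ ⟨l, hl, rfl, hne.symm⟩

theorem forall_succIn {p : ℕ → ℕ → Prop} :
    (∀ x y, SuccIn (steps I) x y → p x y) ↔ ∀ o, Fact.inst o 3 ∈ I →
      (stepOf I o).atom.tag = 0 → p (stepOf I o).atom.x (stepOf I o).atom.y := by
  constructor
  · exact fun h o ho htag => h _ _ ⟨_, ⟨o, ho, rfl⟩, htag, rfl, rfl⟩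
  · rintro h _ _ ⟨_, ⟨o, ho, rfl⟩, htag, rfl, rfl⟩
    exact h o ho htag

theorem holds_precedesSuccOCL (hI : certDiagram.IsInstance I) :
    precedesSuccOCL.Holds certDiagram I I π ρ ↔ ∀ x y, SuccIn (steps I) x y → Precedes I x y := by
  rw [precedesSuccOCL, holds_forAllSucc hI, forall_succIn]
  refine forall₃_congr fun o ho _ => ?_
  exact holds_precedesOCL hI (fun _ => eval_attrOf_step hI ho) fun _ => eval_attrOf_step hI ho

theorem holds_succNeZeroOCL (hI : certDiagram.IsInstance I) :
    succNeZeroOCL.Holds certDiagram I I π ρ ↔ ∀ x, ¬ SuccIn (steps I) x 0 := by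
  have hne : (∀ x, ¬ SuccIn (steps I) x 0) ↔ ∀ x y, SuccIn (steps I) x y → y ≠ 0 :=
    ⟨fun h x y hxy hy => h x (hy ▸ hxy), fun h x hx => h x 0 hx rfl⟩
  rw [hne, succNeZeroOCL, holds_forAllSucc hI, forall_succIn]
  refine forall₃_congr fun o ho _ => not_congr ?_
  exact holds_valEq_of_eval (eval_attrOf_step hI ho) rfl

theorem holds_succInjOCL (hI : certDiagram.IsInstance I) :
    succInjOCL.Holds certDiagram I I π ρ ↔
      ∀ x x' y, SuccIn (steps I) x y → SuccIn (steps I) x' y → x = x' := by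
  have hcurry : (∀ x x' y, SuccIn (steps I) x y → SuccIn (steps I) x' y → x = x') ↔
      ∀ x y, SuccIn (steps I) x y → ∀ x' y', SuccIn (steps I) x' y' → y = y' → x = x' :=
    ⟨fun h x y hx x' y' hx' hy => h x x' y hx (hy ▸ hx'),
      fun h x x' y hx hx' => h x y hx x' y hx' rfl⟩
  simp only [hcurry, forall_succIn]
  rw [succInjOCL, holds_forAllSucc hI]
  refine forall₃_congr fun o ho _ => ?_
  rw [holds_forAllSucc hI]
  refine forall₃_congr fun k hk _ => ?_
  rw [OCL.holds_imp]
  exact imp_congr (holds_valEq_of_eval (eval_attrOf_step hI ho) (eval_attrOf_step hI hk))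
    (holds_valEq_of_eval (eval_attrOf_step hI ho) (eval_attrOf_step hI hk))

theorem holds_justifiedOCL (hI : certDiagram.IsInstance I) {P : List Rule} :
    (justifiedOCL P).Holds certDiagram I I π ρ ↔
      ∀ f ∈ steps I, f.atom.tag = 0 ∨ ∃ r ∈ P, f.Applies (steps I) (Precedes I) r := by
  simp only [justifiedOCL, OCL.holds_forAll_allOf, certDiagram_hasType (three_ne_zero (α := ℕ)),
    forall_mem_steps]
  refine forall₂_congr fun o ho => ?_
  rw [OCL.holds_or, OCL.holds_disj]
  simp only [List.mem_map, exists_exists_and_eq_and]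
  exact or_congr (holds_valEq_of_eval (eval_attrOf_step hI ho) rfl)
    (exists_congr fun r => and_congr_right fun _ => holds_ruleOCL hI ho (by rfl))

theorem holds_inputOCL (hI : certDiagram.IsInstance I) {i : ℕ} :
    (inputOCL i).Holds certDiagram I I π ρ ↔ SuccIn (steps I) i (i + 1) := by
  simp only [inputOCL, OCL.holds_exists_allOf, certDiagram_hasType (three_ne_zero (α := ℕ)),
    SuccIn, exists_mem_steps]
  refine exists_congr fun o => and_congr_right fun ho => ?_
  rw [OCL.holds_and, OCL.holds_and]
  exact and_congr (holds_valEq_of_eval (eval_attrOf_step hI ho) rfl)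
    (and_congr (holds_valEq_of_eval (eval_attrOf_step hI ho) rfl)
      (holds_valEq_of_eval (eval_attrOf_step hI ho) rfl))

theorem holds_goalOCL (hI : certDiagram.IsInstance I) {g n : ℕ} :
    (goalOCL g n).Holds certDiagram I I π ρ ↔ ∃ f ∈ steps I, f.atom.tag = g ∧ f.atom.x = n := by
  simp only [goalOCL, OCL.holds_exists_allOf, certDiagram_hasType (three_ne_zero (α := ℕ)),
    exists_mem_steps]
  refine exists_congr fun o => and_congr_right fun ho => ?_
  rw [OCL.holds_and]
  exact and_congr (holds_valEq_of_eval (eval_attrOf_step hI ho) rfl)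
    (holds_valEq_of_eval (eval_attrOf_step hI ho) rfl)

theorem holds_certOCL (hI : certDiagram.IsInstance I) {P : List Rule} {g n : ℕ} :
    (∀ φ ∈ certOCL P g n, φ.Holds certDiagram I I π ρ) ↔
      Certificate P g n (steps I) (Precedes I) := by
  simp only [certOCL, List.forall_mem_append, List.forall_mem_cons, List.forall_mem_map,
    holds_transOCL hI, holds_irreflOCL hI, holds_precedesSuccOCL hI, holds_succNeZeroOCL hI,
    holds_succInjOCL hI, holds_justifiedOCL hI, holds_goalOCL hI, holds_inputOCL hI,
    List.mem_range]
  constructor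
  · rintro ⟨⟨_, _, hsucc, h0, hinj, hjust, hgoal, -⟩, hinput⟩
    exact ⟨{}, hsucc, h0, hinj, hjust, hinput, hgoal⟩
  · rintro ⟨hR, hsucc, h0, hinj, hjust, hinput, hgoal⟩
    exact ⟨⟨hR.toIsTrans, hR.toIrrefl, hsucc, h0, hinj, hjust, hgoal, List.forall_mem_nil _⟩,
      hinput⟩

end Holds

section Legal

variable {P : List Rule} {g n : ℕ} {I : InfoBase}

theorem certModel_legal_iff :
    (certModel P g n).Legal I ↔ certDiagram.IsInstance I ∧ (∀ o, Fact.inst o 0 ∉ I) ∧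
      ((∃ o, Fact.inst o 2 ∈ I) → Certificate P g n (steps I) (Precedes I)) := by
  refine and_congr_right fun hI => and_congr ?_ ?_
  · simp only [certModel, List.mem_singleton, forall_eq, certArtifact_isState, certDiagram_sub]
    constructor
    · intro h o ho
      simpa using h o 0 ho (Or.inl rfl)
    · rintro h o c hc (rfl | hc')
      · exact absurd hc (h o)
      · exact hc'.2
  · rw [← holds_certOCL hI (π := noVal) (ρ := selfEnv none)]
    simp only [certModel, List.forall_mem_map, OCL.CondHolds, onTermination, OCL.holds_or,
      OCL.holds_isEmpty_allOf, certDiagram_hasType (two_ne_zero (α := ℕ)), ← not_exists,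
      ← imp_iff_not_or]
    exact ⟨fun h ho φ hφ => h φ hφ ho, fun h φ hφ ho => h ho φ hφ⟩

theorem certModel_legal_empty : (certModel P g n).Legal ∅ := by
  refine certModel_legal_iff.2 ⟨?_, by simp, by simp⟩
  constructor <;> simp [ClassDiagram.HasType]

theorem finite_precedes (I : InfoBase) : {u | ∃ v, Precedes I u v}.Finite := by
  have hinj : Function.Injective fun o => Fact.inst o 4 := fun _ _ h => (Fact.inst.inj h).1
  refine ((I.finite_toSet.preimage hinj.injOn).image (attrValue I 0)).subset ?_
  rintro _ ⟨_, l, hl, rfl, rfl⟩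
  exact ⟨l, hl, rfl⟩

theorem derivable_of_legal (hI : (certModel P g n).Legal I) {o : ℕ} (ho : Fact.inst o 2 ∈ I) :
    ∃ y z, Derivable P ⟨g, n, y, z⟩ :=
  ((certModel_legal_iff.1 hI).2.2 ⟨o, ho⟩).derivable (finite_precedes I)

end Legal

/-! ### Information bases from derivations -/

section ObjectsBase

variable {ι : Type*} {M : ClassDiagram} {T : Finset ι} {obj cls : ι → ℕ} {val : ι → ℕ → ℕ}

open Classical in
/-- The information base without links whose objects `obj i`, for `i ∈ T`, have the direct class
`cls i` and the values `val i` of all attributes that `M` declares for this class. -/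
noncomputable def objectsBase (M : ClassDiagram) (T : Finset ι) (obj cls : ι → ℕ)
    (val : ι → ℕ → ℕ) : InfoBase :=
  T.image (fun i => .inst (obj i) (cls i)) ∪ T.biUnion fun i =>
    ((Finset.range M.attrs.length).filter fun a =>
      ∃ d, M.attrs[a]? = some d ∧ M.Sub (cls i) d.owner).image fun a => .val a (obj i) (val i a)

theorem inst_mem_objectsBase {o c : ℕ} :
    .inst o c ∈ objectsBase M T obj cls val ↔ ∃ i ∈ T, obj i = o ∧ cls i = c := by
  simp [objectsBase]

theorem link_notMem_objectsBase {r o o' : ℕ} : .link r o o' ∉ objectsBase M T obj cls val := by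
  simp [objectsBase]

theorem val_mem_objectsBase {a o v : ℕ} : .val a o v ∈ objectsBase M T obj cls val ↔
    ∃ i ∈ T, (∃ d, M.attrs[a]? = some d ∧ M.Sub (cls i) d.owner) ∧ obj i = o ∧ val i a = v := by
  simp only [objectsBase, Finset.mem_union, Finset.mem_image, Finset.mem_biUnion,
    Finset.mem_filter, Finset.mem_range, Fact.val.injEq, reduceCtorEq, and_false, exists_false,
    false_or]
  refine exists_congr fun i => and_congr_right fun _ => ⟨?_, ?_⟩
  · rintro ⟨a, ⟨-, hd⟩, rfl, h⟩
    exact ⟨hd, h⟩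
  · rintro ⟨hd, h⟩
    exact ⟨a, ⟨(List.getElem?_eq_some_iff.1 hd.choose_spec.1).1, hd⟩, rfl, h⟩

theorem objectsBase_isInstance (hassocs : M.assocs = []) (hobj : Function.Injective obj)
    (hcls : ∀ i ∈ T, cls i < M.numClasses) : M.IsInstance (objectsBase M T obj cls val) where
  inst_class o c h := by
    obtain ⟨i, hi, -, rfl⟩ := inst_mem_objectsBase.1 h
    exact hcls i hi
  inst_unique o c d hc hd := by
    obtain ⟨i, -, rfl, rfl⟩ := inst_mem_objectsBase.1 hc
    obtain ⟨j, -, hij, rfl⟩ := inst_mem_objectsBase.1 hd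
    rw [hobj hij]
  link_typed _ _ _ h := absurd h link_notMem_objectsBase
  im_mult := by simp [hassocs]
  dom_mult := by simp [hassocs]
  val_typed a o v h := by
    obtain ⟨i, hi, ⟨d, hd, hsub⟩, rfl, -⟩ := val_mem_objectsBase.1 h
    exact ⟨d, hd, cls i, inst_mem_objectsBase.2 ⟨i, hi, rfl, rfl⟩, hsub⟩
  val_unique a o v w hv hw := by
    obtain ⟨i, -, -, rfl, rfl⟩ := val_mem_objectsBase.1 hv
    obtain ⟨j, -, -, hij, rfl⟩ := val_mem_objectsBase.1 hw
    rw [hobj hij]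
  val_required a d o hd _ ho := by
    obtain ⟨c, hc, hsub⟩ := ho
    obtain ⟨i, hi, rfl, rfl⟩ := inst_mem_objectsBase.1 hc
    exact ⟨val i a, val_mem_objectsBase.2 ⟨i, hi, ⟨d, hd, hsub⟩, rfl, rfl⟩⟩

end ObjectsBase

/-- The objects of an information base that stores a certificate: an artifact instance, derivation
steps and pairs of numbers. -/
inductive CertObject
  | artifact
  | step (f : DerivationStep)
  | pair (u v : ℕ)
  deriving DecidableEq, Encodable

namespace CertObject

/-- The class in `certDiagram`, where the artifact instance is terminated. -/
def cls : CertObject → ℕ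
  | artifact => 2
  | step _ => 3
  | pair _ _ => 4

/-- The attribute values, laid out as in `certDiagram`. -/
def attr : CertObject → ℕ → ℕ
  | artifact, _ => 0
  | step f, 2 => f.atom.tag
  | step f, 3 => f.atom.x
  | step f, 4 => f.atom.y
  | step f, 5 => f.atom.z
  | step f, 6 => f.rank
  | step f, a => f.val (Fin.ofNat 10 (a - 7))
  | pair u _, 0 => u
  | pair _ v, _ => v

theorem exists_injective_artifact (o : ℕ) :
    ∃ obj : CertObject → ℕ, Function.Injective obj ∧ obj artifact = o :=
  ⟨Equiv.swap o (Encodable.encode artifact) ∘ Encodable.encode,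
    (Equiv.injective _).comp Encodable.encode_injective, Equiv.swap_apply_right _ _⟩

/-- The artifact instance, the steps in `S`, and the pairs in the relation `LtBelow N`. -/
def ofCertificate (S : Finset DerivationStep) (N : ℕ) : Finset CertObject :=
  insert artifact <| S.image step ∪
    ((Finset.range N ×ˢ Finset.range N).filter fun q => q.1 < q.2).image fun q => pair q.1 q.2

variable {S : Finset DerivationStep} {N u v : ℕ} {f : DerivationStep}

theorem artifact_mem : artifact ∈ ofCertificate S N := Finset.mem_insert_self ..

theorem step_mem : step f ∈ ofCertificate S N ↔ f ∈ S := by simp [ofCertificate]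

theorem pair_mem : pair u v ∈ ofCertificate S N ↔ LtBelow N u v := by
  simp only [ofCertificate, LtBelow, Finset.mem_insert, Finset.mem_union, Finset.mem_image,
    Finset.mem_filter, Finset.mem_product, Finset.mem_range, Prod.exists, pair.injEq,
    reduceCtorEq, and_false, exists_false, false_or]
  constructor
  · rintro ⟨_, _, ⟨⟨-, hv⟩, huv⟩, rfl, rfl⟩
    exact ⟨huv, hv⟩
  · rintro ⟨huv, hv⟩
    exact ⟨u, v, ⟨⟨huv.trans hv, hv⟩, huv⟩, rfl, rfl⟩

end CertObject

/-- An information base that stores the steps in `S` and the pairs in `LtBelow N`, besides a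
terminated artifact instance. -/
noncomputable def certBase (S : Finset DerivationStep) (N : ℕ) (obj : CertObject → ℕ) : InfoBase :=
  objectsBase certDiagram (CertObject.ofCertificate S N) obj CertObject.cls CertObject.attr

section CertBase

open CertObject

variable {S : Finset DerivationStep} {N : ℕ} {obj : CertObject → ℕ}

theorem certBase_isInstance (hobj : Function.Injective obj) :
    certDiagram.IsInstance (certBase S N obj) :=
  objectsBase_isInstance rfl hobj fun i _ => by
    cases i <;> simp [CertObject.cls, certDiagram]

theorem inst_three_mem_certBase {o : ℕ} :
    .inst o 3 ∈ certBase S N obj ↔ ∃ f ∈ S, obj (step f) = o := by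
  rw [certBase, inst_mem_objectsBase]
  constructor
  · rintro ⟨_ | f | _, hi, ho, h⟩
    · cases h
    · exact ⟨f, step_mem.1 hi, ho⟩
    · cases h
  · exact fun ⟨f, hf, ho⟩ => ⟨step f, step_mem.2 hf, ho, rfl⟩

theorem inst_four_mem_certBase {o : ℕ} :
    .inst o 4 ∈ certBase S N obj ↔ ∃ u v, LtBelow N u v ∧ obj (pair u v) = o := by
  rw [certBase, inst_mem_objectsBase]
  constructor
  · rintro ⟨_ | _ | ⟨u, v⟩, hi, ho, h⟩
    · cases h
    · cases h
    · exact ⟨u, v, pair_mem.1 hi, ho⟩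
  · exact fun ⟨u, v, huv, ho⟩ => ⟨pair u v, pair_mem.2 huv, ho, rfl⟩

theorem attrValue_certBase (hobj : Function.Injective obj) {i : CertObject}
    (hi : i ∈ ofCertificate S N) {a : ℕ} (ha : a < 17) (hcls : i.cls = if a < 2 then 4 else 3) :
    attrValue (certBase S N obj) a (obj i) = i.attr a :=
  attrValue_eq (certBase_isInstance hobj) <| val_mem_objectsBase.2
    ⟨i, hi, ⟨_, certDiagram_getElem?_attrs ha, certDiagram_sub.2 (.inl hcls)⟩, rfl, rfl⟩

theorem stepOf_certBase (hobj : Function.Injective obj) {f : DerivationStep} (hf : f ∈ S) :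
    stepOf (certBase S N obj) (obj (step f)) = f := by
  have hattr {a : ℕ} (h2 : ¬ a < 2) (h17 : a < 17) :
      attrValue (certBase S N obj) a (obj (step f)) = (step f).attr a :=
    attrValue_certBase hobj (step_mem.2 hf) h17 (if_neg h2).symm
  have hval (i : Fin 10) : attrValue (certBase S N obj) (7 + i) (obj (step f)) = f.val i := by
    rw [hattr (by omega) (by omega), Nat.add_comm, attr]
    · simp
    all_goals omega
  simp only [stepOf, hval]
  rw [hattr, hattr, hattr, hattr, hattr] <;> first | rfl | decide

theorem steps_certBase (hobj : Function.Injective obj) : steps (certBase S N obj) = S := by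
  ext f
  constructor
  · rintro ⟨_, ho, rfl⟩
    obtain ⟨f, hf, rfl⟩ := inst_three_mem_certBase.1 ho
    rwa [stepOf_certBase hobj hf]
  · exact fun hf => ⟨obj (step f), inst_three_mem_certBase.2 ⟨f, hf, rfl⟩, stepOf_certBase hobj hf⟩

theorem precedes_certBase (hobj : Function.Injective obj) :
    Precedes (certBase S N obj) = LtBelow N := by
  have hattr {u v a : ℕ} (huv : LtBelow N u v) (ha : a < 2) :
      attrValue (certBase S N obj) a (obj (pair u v)) = (pair u v).attr a :=
    attrValue_certBase hobj (pair_mem.2 huv) (by omega) (if_pos ha).symm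
  ext u v
  constructor
  · rintro ⟨_, hl, rfl, rfl⟩
    obtain ⟨u, v, huv, rfl⟩ := inst_four_mem_certBase.1 hl
    rwa [hattr huv (by decide), hattr huv (by decide)]
  · exact fun huv => ⟨_, inst_four_mem_certBase.2 ⟨u, v, huv, rfl⟩, hattr huv (by decide),
      hattr huv (by decide)⟩

end CertBase

theorem exists_legal_of_derivable {P : List Rule} {g n y z : ℕ}
    (h : Derivable P ⟨g, n, y, z⟩) (o : ℕ) :
    ∃ J, (certModel P g n).Legal J ∧ Fact.inst o 2 ∈ J := by
  obtain ⟨S, N, hcert⟩ := h.exists_certificate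
  obtain ⟨obj, hobj, rfl⟩ := CertObject.exists_injective_artifact o
  refine ⟨certBase S N obj, certModel_legal_iff.2 ⟨certBase_isInstance hobj, fun u hu => ?_,
    fun _ => ?_⟩, inst_mem_objectsBase.2 ⟨.artifact, CertObject.artifact_mem, rfl, rfl⟩⟩
  · obtain ⟨i, -, -, hi⟩ := inst_mem_objectsBase.1 hu
    cases i <;> cases hi
  · rwa [steps_certBase hobj, precedes_certBase hobj]

open Relation

/-! ### Runs of a model -/

theorem of_reflTransGen {α : Type*} {r : α → α → Prop} (p : α → Prop) {a b : α}
    (hp : ∀ a b, r a b → p a → p b) (h : ReflTransGen r a b) (ha : p a) : p b := by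
  induction h with
  | refl => exact ha
  | tail _ h ih => exact hp _ _ h ih

section Runs

variable {B : Model} {A : Artifact} {D : InfoBase} {s s' : Config} {x : ℕ}

theorem Task.exists_exec {t : Task} {self self' : Option ℕ} {I J : InfoBase} {π : ℕ → ℕ}
    (hself : if t.creates = true then self = none else self' = self)
    (htype : ∀ o, self = some o → B.diagram.HasType I o A.cls)
    (hpre : t.pre.Holds B.diagram I I (fun i => some (π i)) (selfEnv self))
    (hJ : t.Admissible B A π self' I J) : ∃ J', t.Exec B A self self' I J' := by
  obtain ⟨J', hJ', hmin⟩ := WellFounded.has_min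
    (measure fun K : InfoBase => (symmDiff I K).card).wf {K | t.Admissible B A π self' I K} ⟨J, hJ⟩
  refine ⟨J', hself, htype, π, hpre, hJ', fun K hK hsub => symmDiff_right_injective I ?_⟩
  exact Finset.eq_of_subset_of_card_le hsub (not_lt.1 (hmin K hK))

theorem Task.Exec.legal {t : Task} {self self' : Option ℕ} {I J : InfoBase}
    (h : t.Exec B A self self' I J) : B.Legal J := by
  obtain ⟨-, -, π, -, hJ, -⟩ := h
  exact hJ.1

theorem Task.Exec.post_holds {t : Task} {self self' : Option ℕ} {I J : InfoBase}
    (h : t.Exec B A self self' I J) :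
    ∃ π : ℕ → ℕ, t.post.Holds B.diagram I J (fun i => some (π i)) (selfEnv self') := by
  obtain ⟨-, -, π, -, hJ, -⟩ := h
  exact ⟨π, hJ.2.2.1⟩

theorem Model.Step.legal (h : B.Step s s') (hs : B.Legal s.ib) : B.Legal s'.ib := by
  cases h with
  | start => exact hs
  | fire I J ps i k A t Q n nd self self' rest c d hA ht hQ hn hc hd he hps =>
    cases nd with
    | action t => exact Task.Exec.legal he
    | _ => exact he.2 ▸ hs
  | finish => exact hs

theorem Model.legal_of_reflTransGen (h : ReflTransGen B.Step s s') (hs : B.Legal s.ib) :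
    B.Legal s'.ib :=
  of_reflTransGen (fun s : Config => B.Legal s.ib) (fun _ _ => Model.Step.legal) h hs

/-- The activities that are running in `s` have distinct artifact instances. -/
def Config.Separated (s : Config) : Prop := (s.procs.filterMap Proc.self).Nodup

theorem Config.separated_cons {I : InfoBase} {p : Proc} {ps : Multiset Proc} :
    Separated ⟨I, p ::ₘ ps⟩ ↔
      (∀ q ∈ ps, ∀ o, p.self = some o → q.self ≠ some o) ∧ Separated ⟨I, ps⟩ := by
  rcases h : p.self with _ | o
  · simp [Separated, Multiset.filterMap_cons_none _ _ h]
  · simp [Separated, Multiset.filterMap_cons_some _ _ _ h, Multiset.mem_filterMap]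

theorem Model.Step.separated (h : B.Step s s') (hs : s.Separated) : s'.Separated := by
  cases h with
  | start I ps i k A t Q n self hA ht hQ hn hself hcond =>
    refine Config.separated_cons.2 ⟨?_, hs⟩
    rcases hself with ⟨-, rfl⟩ | ⟨v, o, -, rfl, -, hps⟩
    · simp
    · rintro q hq _ ⟨⟩
      exact hps q hq
  | fire I J ps i k A t Q n nd self self' rest c d hA ht hQ hn hc hd he hps =>
    exact Config.separated_cons.2 ⟨hps, (Config.separated_cons.1 hs).2⟩
  | finish => exact (Config.separated_cons.1 hs).2

theorem Model.terminates_iff : B.Terminates D ↔ ∀ s, ReflTransGen B.Step ⟨D, 0⟩ s →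
    ∀ A ∈ B.artifacts, ∀ x, B.diagram.HasType s.ib x A.cls →
      s ∈ OrderHom.lfp (B.reachOp A x) := by
  constructor
  · intro h s hs
    have hmem : s ∈ OrderHom.gfp B.terminationOp := by
      refine of_reflTransGen (· ∈ OrderHom.gfp _) (fun s s' hss' hmem => ?_) hs h
      rw [← OrderHom.map_gfp] at hmem
      exact hmem.2 s' hss'
    rw [← OrderHom.map_gfp] at hmem
    exact hmem.1
  · intro h
    have hle : {s | ReflTransGen B.Step ⟨D, 0⟩ s} ≤ OrderHom.gfp B.terminationOp :=
      OrderHom.le_gfp _ fun s hs => ⟨h s hs, fun s' hss' => hs.tail hss'⟩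
    exact hle .refl

theorem Model.mem_lfp_reachOp : s ∈ OrderHom.lfp (B.reachOp A x) ↔
    B.diagram.HasType s.ib x A.final ∨ (B.diagram.HasType s.ib x A.cls ∧
      ∃ s', B.Step s s' ∧ s' ∈ OrderHom.lfp (B.reachOp A x)) := by
  conv_lhs => rw [← OrderHom.map_lfp]
  rfl

theorem Model.exists_reachable_of_mem_lfp_reachOp (h : s ∈ OrderHom.lfp (B.reachOp A x)) :
    ∃ s', ReflTransGen B.Step s s' ∧ B.diagram.HasType s'.ib x A.final := by
  have hle : OrderHom.lfp (B.reachOp A x) ≤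
      {s | ∃ s', ReflTransGen B.Step s s' ∧ B.diagram.HasType s'.ib x A.final} := by
    refine OrderHom.lfp_le _ ?_
    rintro s (hs | ⟨-, s₁, hss₁, s', hs', hfinal⟩)
    · exact ⟨s, .refl, hs⟩
    · exact ⟨s', hs'.head hss₁, hfinal⟩
  exact hle h

end Runs

/-! ### Termination of the model of a Horn program -/

section CertModel

variable {P : List Rule} {g n : ℕ} {I J : InfoBase} {ps : Multiset Proc} {s s' : Config} {x : ℕ}

theorem certModel_artifacts_getElem? {i : ℕ} {A : Artifact} :
    (certModel P g n).artifacts[i]? = some A ↔ i = 0 ∧ A = certArtifact := by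
  rcases i with _ | i <;> simp [certModel, eq_comm]

theorem inst_of_hasType_zero (hI : (certModel P g n).Legal I) (hx : certDiagram.HasType I x 0) :
    Fact.inst x 1 ∈ I ∨ Fact.inst x 2 ∈ I := by
  obtain ⟨c, hc, hsub⟩ := hx
  rcases certDiagram_sub.1 hsub with rfl | ⟨-, rfl | rfl⟩
  · exact absurd hc ((certModel_legal_iff.1 hI).2.1 x)
  · exact .inl hc
  · exact .inr hc

theorem hasType_zero_of_inst {c : ℕ} (hc : c = 1 ∨ c = 2) (hx : Fact.inst x c ∈ I) :
    certDiagram.HasType I x 0 := ⟨c, hx, certDiagram_sub.2 (.inr ⟨rfl, hc⟩)⟩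

theorem certModel_admissible {t : Task} {c : ℕ} (hpost : t.post = .oclIsTypeOf 0 c)
    (hJ : (certModel P g n).Legal J) (hx : Fact.inst x c ∈ J)
    (hnew : t.creates = true → ¬ I.Exists x ∧ certDiagram.HasType J x 0) (π : ℕ → ℕ) :
    t.Admissible (certModel P g n) certArtifact π (some x) I J := by
  refine ⟨hJ, ?_, ?_, fun h => ⟨x, rfl, hnew h⟩⟩
  · rintro (_ | _ | _) <;>
      simp [ClassDiagram.ROFact, ClassDiagram.ROAttr, certModel, certDiagram]
  · rw [hpost]
    exact ⟨x, rfl, hx⟩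

theorem inst_of_exec {t : Task} {self : Option ℕ} {c : ℕ} (hpost : t.post = .oclIsTypeOf 0 c)
    (h : t.Exec (certModel P g n) certArtifact self (some x) I J) : Fact.inst x c ∈ J := by
  obtain ⟨π, hπ⟩ := h.post_holds
  rw [hpost] at hπ
  obtain ⟨_, ⟨⟩, hx⟩ := hπ
  exact hx

theorem exists_legal_running (P : List Rule) (g n x : ℕ) :
    ∃ J, (certModel P g n).Legal J ∧ Fact.inst x 1 ∈ J := by
  refine ⟨objectsBase certDiagram {()} (fun _ => x) (fun _ => 1) fun _ _ => 0,
    certModel_legal_iff.2 ⟨objectsBase_isInstance rfl (Function.injective_of_subsingleton _) ?_,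
      ?_, ?_⟩, ?_⟩
  all_goals simp [inst_mem_objectsBase, certDiagram]

theorem exists_exec_createTask (P : List Rule) (g n x : ℕ) :
    ∃ J, createTask.Exec (certModel P g n) certArtifact none (some x) ∅ J := by
  obtain ⟨J, hJ, hx⟩ := exists_legal_running P g n x
  exact Task.exists_exec rfl (by simp) trivial <| certModel_admissible rfl hJ hx
    (fun _ => ⟨by simp [InfoBase.Exists], hasType_zero_of_inst (.inl rfl) hx⟩) 0

theorem exists_reachable_running (P : List Rule) (g n x : ℕ) : ∃ s,
    ReflTransGen (certModel P g n).Step ⟨∅, 0⟩ s ∧ (certModel P g n).Legal s.ib ∧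
      Fact.inst x 1 ∈ s.ib := by
  obtain ⟨J, hJ⟩ := exists_exec_createTask P g n x
  refine ⟨_, .tail (.single (.start ∅ 0 0 0 certArtifact ⟨none, 0, .tt, 1⟩ createActivity 0 none
    rfl rfl rfl rfl (.inl ⟨rfl, rfl⟩) trivial)) (.fire ∅ J 0 0 0 certArtifact ⟨none, 0, .tt, 1⟩
    createActivity 1 (.action createTask) none (some x) 0 {0} {1} rfl rfl rfl rfl rfl rfl hJ ?_),
    hJ.legal, inst_of_exec rfl hJ⟩
  simp

/-- If the activity `p` of a `certModel` has an artifact instance, then it is able to proceed: a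
creation has reached its final node, and a completion has a token on an edge to its merge node or
to its action. -/
def Proc.CanProceed (p : Proc) : Prop :=
  p.art = 0 ∧ ∀ o, p.self = some o →
    (p.trans = 0 ∧ 1 ∈ p.tokens) ∨ (p.trans = 1 ∧ ∃ e < 3, e ∈ p.tokens)

theorem canProceed_of_step (h : (certModel P g n).Step s s')
    (hs : ∀ p ∈ s.procs, p.CanProceed) : ∀ p ∈ s'.procs, p.CanProceed := by
  cases h with
  | start I ps i k A t Q m self hA ht hQ hm hself hcond =>
    obtain ⟨rfl, rfl⟩ := certModel_artifacts_getElem?.1 hA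
    refine Multiset.forall_mem_cons.2 ⟨⟨rfl, fun o ho => ?_⟩, hs⟩
    rcases k with _ | _ | k <;> cases ht
    · rcases hself with ⟨-, rfl⟩ | ⟨_, _, h, -⟩
      · cases ho
      · cases h
    · cases hQ
      rcases m with _ | _ | _ | _ | m <;> cases hm
      exact .inr ⟨rfl, 0, by decide, Multiset.mem_singleton_self 0⟩
  | fire I J ps i k A t Q m nd self self' rest c d hA ht hQ hm hc hd he hps =>
    obtain ⟨rfl, rfl⟩ := certModel_artifacts_getElem?.1 hA
    refine Multiset.forall_mem_cons.2 ⟨⟨rfl, fun _ _ => ?_⟩, (Multiset.forall_mem_cons.1 hs).2⟩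
    rcases k with _ | _ | k <;> cases ht <;> cases hQ
    · rcases m with _ | _ | _ | m <;> cases hm
      · exact hc.elim
      · obtain rfl : d = {1} := hd
        exact .inl ⟨rfl, by simp⟩
      · exact hc.elim
    · rcases m with _ | _ | _ | _ | m <;> cases hm
      · exact hc.elim
      · obtain rfl : d = {1} := hd
        exact .inr ⟨rfl, 1, by decide, by simp⟩
      · obtain rfl : d = {2, 3} := hd
        exact .inr ⟨rfl, 2, by decide, by simp⟩
      · exact hc.elim
  | finish => exact (Multiset.forall_mem_cons.1 hs).2

theorem exists_exec_completeTask {y z : ℕ} (hd : Derivable P ⟨g, n, y, z⟩)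
    (hx : certDiagram.HasType I x 0) :
    ∃ J, completeTask.Exec (certModel P g n) certArtifact (some x) (some x) I J := by
  obtain ⟨J, hJ, hxJ⟩ := exists_legal_of_derivable hd x
  refine Task.exists_exec rfl ?_ trivial
    (certModel_admissible rfl hJ hxJ (fun h => Bool.noConfusion h) 0)
  rintro _ ⟨⟩
  exact hx

theorem mem_lfp_of_inst_two (hx : Fact.inst x 2 ∈ s.ib) :
    s ∈ OrderHom.lfp ((certModel P g n).reachOp certArtifact x) :=
  Model.mem_lfp_reachOp.2 (.inl ⟨2, hx, .refl⟩)

theorem mem_lfp_of_step (hx : certDiagram.HasType s.ib x 0) (h : (certModel P g n).Step s s')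
    (hs' : s' ∈ OrderHom.lfp ((certModel P g n).reachOp certArtifact x)) :
    s ∈ OrderHom.lfp ((certModel P g n).reachOp certArtifact x) :=
  Model.mem_lfp_reachOp.2 (.inr ⟨hx, s', h, hs'⟩)

theorem mem_lfp_of_completing {y z : ℕ} (hd : Derivable P ⟨g, n, y, z⟩)
    (hx : certDiagram.HasType I x 0) (hps : ∀ q ∈ ps, q.self ≠ some x) {tokens : Multiset ℕ}
    {e : ℕ} (he : e < 3) (htok : e ∈ tokens) :
    ⟨I, ⟨0, 1, some x, tokens⟩ ::ₘ ps⟩ ∈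
      OrderHom.lfp ((certModel P g n).reachOp certArtifact x) := by
  have hps' : ∀ q ∈ ps, ∀ o, some x = some o → q.self ≠ some o := by
    rintro q hq _ ⟨⟩
    exact hps q hq
  have haction (rest : Multiset ℕ) : ⟨I, ⟨0, 1, some x, rest + {1}⟩ ::ₘ ps⟩ ∈
      OrderHom.lfp ((certModel P g n).reachOp certArtifact x) := by
    obtain ⟨J, hJ⟩ := exists_exec_completeTask hd hx
    refine mem_lfp_of_step hx ?_
      (mem_lfp_of_inst_two (s := ⟨J, ⟨0, 1, some x, rest + {2, 3}⟩ ::ₘ ps⟩) (inst_of_exec rfl hJ))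
    exact .fire I J ps 0 1 certArtifact ⟨some 1, 1, .tt, 2⟩ completeActivity 2
      (.action completeTask) (some x) (some x) rest {1} {2, 3} rfl rfl rfl rfl rfl rfl hJ hps'
  obtain ⟨rest, rfl⟩ := le_iff_exists_add'.1 (Multiset.singleton_le.2 htok)
  by_cases h1 : e = 1
  · exact h1 ▸ haction rest
  · refine mem_lfp_of_step hx ?_ (haction rest)
    exact .fire I I ps 0 1 certArtifact ⟨some 1, 1, .tt, 2⟩ completeActivity 1 .merge (some x)
      (some x) rest {e} {1} rfl rfl rfl rfl ⟨e, by interval_cases e <;> trivial, rfl⟩ rfl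
      ⟨rfl, rfl⟩ hps'

theorem mem_lfp_of_idle {y z : ℕ} (hd : Derivable P ⟨g, n, y, z⟩) (hx : Fact.inst x 1 ∈ I)
    (hps : ∀ q ∈ ps, q.self ≠ some x) :
    ⟨I, ps⟩ ∈ OrderHom.lfp ((certModel P g n).reachOp certArtifact x) := by
  have hx' := hasType_zero_of_inst (.inl rfl) hx
  refine mem_lfp_of_step hx' ?_ (mem_lfp_of_completing hd hx' hps (e := 0) (by decide)
    (tokens := {0}) (Multiset.mem_singleton_self 0))
  exact .start I ps 0 1 certArtifact ⟨some 1, 1, .tt, 2⟩ completeActivity 0 (some x) rfl rfl rfl rfl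
    (.inr ⟨1, x, rfl, rfl, hx, hps⟩) trivial

theorem mem_lfp_of_derivable {y z : ℕ} (hd : Derivable P ⟨g, n, y, z⟩)
    (hlegal : (certModel P g n).Legal s.ib) (hsep : s.Separated)
    (hproceed : ∀ p ∈ s.procs, p.CanProceed) (hx : certDiagram.HasType s.ib x 0) :
    s ∈ OrderHom.lfp ((certModel P g n).reachOp certArtifact x) := by
  obtain ⟨I, ps⟩ := s
  rcases inst_of_hasType_zero hlegal hx with hx1 | hx2
  · by_cases hps : ∀ q ∈ ps, q.self ≠ some x
    · exact mem_lfp_of_idle hd hx1 hps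
    push Not at hps
    obtain ⟨⟨art, k, self, tokens⟩, hp, rfl⟩ := hps
    obtain ⟨rfl, hk⟩ := hproceed _ hp
    obtain ⟨ps, rfl⟩ := Multiset.exists_cons_of_mem hp
    have hps : ∀ q ∈ ps, q.self ≠ some x :=
      fun q hq => (Config.separated_cons.1 hsep).1 q hq x rfl
    rcases hk x rfl with ⟨rfl, htok⟩ | ⟨rfl, e, he, htok⟩
    · refine mem_lfp_of_step hx ?_ (mem_lfp_of_idle hd hx1 hps)
      exact .finish I ps 0 0 certArtifact ⟨none, 0, .tt, 1⟩ createActivity 2 x 1 tokens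
        rfl rfl rfl rfl (by decide) htok hx1
    · exact mem_lfp_of_completing hd hx hps he htok
  · exact mem_lfp_of_inst_two hx2

theorem certModel_terminates_iff :
    (certModel P g n).Terminates ∅ ↔ ∃ y z, Derivable P ⟨g, n, y, z⟩ := by
  rw [Model.terminates_iff]
  constructor
  · intro h
    obtain ⟨s, hs, hlegal, hx⟩ := exists_reachable_running P g n 0
    obtain ⟨s', hs', c, hc, hsub⟩ := Model.exists_reachable_of_mem_lfp_reachOp <|
      h s hs certArtifact (List.mem_cons_self ..) 0 (hasType_zero_of_inst (.inl rfl) hx)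
    obtain rfl : c = 2 := by simpa [certArtifact] using certDiagram_sub.1 hsub
    exact derivable_of_legal (of_reflTransGen (fun s : Config => Model.Legal _ s.ib)
      (fun _ _ => Model.Step.legal) hs' hlegal) hc
  · rintro ⟨y, z, hd⟩ s hs A hA x hx
    obtain rfl : A = certArtifact := List.mem_singleton.1 hA
    exact mem_lfp_of_derivable hd
      (Model.legal_of_reflTransGen hs certModel_legal_empty)
      (of_reflTransGen Config.Separated (fun _ _ => Model.Step.separated) hs Multiset.nodup_zero)
      (of_reflTransGen (fun s : Config => ∀ p ∈ s.procs, p.CanProceed)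
        (fun _ _ => canProceed_of_step) hs fun _ hp => absurd hp (Multiset.notMem_zero _)) hx

end CertModel

/-! ### Computability of the reduction -/

section PrimrecCode

variable {α : Type*} [Primcodable α] {φ ψ : α → OCL}

theorem primrec_code_and (hφ : Primrec fun i => (φ i).code)
    (hψ : Primrec fun i => (ψ i).code) : Primrec fun i => (OCL.and (φ i) (ψ i)).code :=
  Primrec.encode.comp (.pair (.const 8) (Primrec.encode.comp (.pair hφ hψ)))

theorem primrec_code_or (hφ : Primrec fun i => (φ i).code)
    (hψ : Primrec fun i => (ψ i).code) : Primrec fun i => (OCL.or (φ i) (ψ i)).code :=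
  Primrec.encode.comp (.pair (.const 9) (Primrec.encode.comp (.pair hφ hψ)))

theorem primrec_code_exists (p : Path) (x : ℕ) (hφ : Primrec fun i => (φ i).code) :
    Primrec fun i => (OCL.exists_ p x (φ i)).code :=
  Primrec.encode.comp (.pair (.const 10) (Primrec.encode.comp
    (.pair (.const p.code) (.pair (.const x) hφ))))

theorem primrec_code_valEq_const (s : ValExpr) {v : α → ℕ} (hv : Primrec v) :
    Primrec fun i => (OCL.valEq s (.const (v i))).code := by
  have hconst : Primrec fun i => (ValExpr.const (v i)).code :=
    Primrec.encode.comp (.pair (.const 0) hv)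
  exact primrec_code_and
    (Primrec.encode.comp (.pair (.const 3) (Primrec.encode.comp (.pair (.const s.code) hconst))))
    (Primrec.encode.comp (.pair (.const 3) (Primrec.encode.comp (.pair hconst (.const s.code)))))

end PrimrecCode

theorem primrec_code_inputOCL : Primrec fun i => (inputOCL i).code :=
  primrec_code_exists _ _ (primrec_code_and (primrec_code_valEq_const _ (.const 0))
    (primrec_code_and (primrec_code_valEq_const _ .id) (primrec_code_valEq_const _ .succ)))

theorem primrec_code_goalOCL (g : ℕ) : Primrec fun n => (goalOCL g n).code :=
  primrec_code_exists _ _ (primrec_code_and (primrec_code_valEq_const _ (.const g))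
    (primrec_code_valEq_const _ .id))

theorem primrec_code_certModel (P : List Rule) (g : ℕ) :
    Primrec fun n => (certModel P g n).code := by
  have hgoal : Primrec fun n => (onTermination (goalOCL g n)).code :=
    primrec_code_or (.const _) (primrec_code_goalOCL g)
  have hinput : Primrec fun n : ℕ =>
      (List.range n).map fun i => (onTermination (inputOCL i)).code :=
    Primrec.list_map Primrec.list_range
      ((primrec_code_or (.const _) primrec_code_inputOCL).comp Primrec.snd)
  have hfixed : Primrec fun n : ℕ => [transOCL, irreflOCL, precedesSuccOCL, succNeZeroOCL,
      succInjOCL, justifiedOCL P].map (fun φ => (onTermination φ).code) ++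
        [(onTermination (goalOCL g n)).code] :=
    Primrec.list_append.comp (.const _) (Primrec.list_cons.comp hgoal (.const []))
  have hconstraints : Primrec fun n => (certModel P g n).constraints.map OCL.code :=
    (Primrec.list_append.comp hfixed hinput).of_eq fun n => by
      simp [certModel, certOCL, Function.comp_def]
  exact Primrec.encode.comp (.pair (.const certDiagram.code)
    (.pair hconstraints (.const ([certArtifact].map Artifact.code))))

/-! ### Undecidability -/

theorem exists_derivable_program_iff_dom (c : Code) (n : ℕ) :
    (∃ y z, Derivable (program c) ⟨c.encodeCode + 5, n, y, z⟩) ↔ (c.eval n).Dom := by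
  rw [Part.dom_iff_mem]
  constructor
  · rintro ⟨y, z, h⟩
    exact ⟨y, (Atom.isTrue_graph c n y).1 h.isTrue⟩
  · rintro ⟨y, hy⟩
    exact ⟨y, y, (derivable_program_graph_iff c n y).2 hy⟩

theorem exists_code_not_computable_dom :
    ∃ c : Code, ¬ ∃ f : ℕ → Bool, Computable f ∧ ∀ n, f n = true ↔ (c.eval n).Dom := by
  have hpart : Partrec fun m : ℕ => (Denumerable.ofNat Code m).eval 0 :=
    Code.eval_part.comp (Computable.ofNat Code) (Computable.const 0)
  obtain ⟨c, hc⟩ := Code.exists_code.1 (Partrec.nat_iff.1 hpart)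
  refine ⟨c, fun ⟨f, hf, h⟩ => ComputablePred.halting_problem 0 ?_⟩
  refine ComputablePred.computable_iff.2
    ⟨fun d => f (Encodable.encode d), hf.comp Computable.encode, funext fun d => propext ?_⟩
  simp only [h, hc, Denumerable.ofNat_encode]

end BAUML

theorem mainTheorem4 :
    ¬ ∃ f : ℕ → Bool, Computable f ∧
      ∀ B : BAUML.Model, B.WellFormed → B.Unidirectional → B.Legal ∅ →
        (f B.code = true ↔ B.Terminates ∅) := by
  rintro ⟨f, hf, h⟩
  obtain ⟨c, hc⟩ := BAUML.exists_code_not_computable_dom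
  let B (n : ℕ) : BAUML.Model := BAUML.certModel (BAUML.program c) (c.encodeCode + 5) n
  refine hc ⟨fun n => f (B n).code, hf.comp (BAUML.primrec_code_certModel _ _).to_comp, fun n => ?_⟩
  calc f (B n).code = true
    _ ↔ (B n).Terminates ∅ := h (B n) (BAUML.certModel_wellFormed ..)
      (BAUML.certModel_unidirectional ..) BAUML.certModel_legal_empty
    _ ↔ ∃ y z, BAUML.Derivable (BAUML.program c) ⟨c.encodeCode + 5, n, y, z⟩ :=
      BAUML.certModel_terminates_iff
    _ ↔ (c.eval n).Dom := BAUML.exists_derivable_program_iff_dom c n
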